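/- **Conventions.** Let $P$ be a finite graded poset of rank $n+1$ with least element $\hat 0$ and greatest element $\hat 1$. For $S\subseteq\{1,\dots,n\}$ let $\alpha_P(S)$ be the number of chains $C\subseteq P\setminus\{\hat 0,\hat 1\}$ whose set of ranks is $S$, let $\beta_P(S)=\sum_{T\subseteq S}(-1)^{|S\setminus T|}\alpha_P(T)$, and let $\Psi_P=\sum_{S}\beta_P(S)\,u_S$, where $u_S=u_1\cdots u_n$ is the monomial in noncommuting variables $a,b$ with $u_i=b$ if $i\in S$ and $u_i=a$ otherwise (for a one-point poset, $\Psi_P=1$). Put $c=a+b$ and $d=ab+ba$. If $\Psi_P$ is a polynomial in $c$ and $d$ with integer coefficients, it is called the cd-index of $P$. The pyramid $\mathrm{Pyr}(P)$ is the product of $P$ with a two-element chain; the shaving of $P$ at an atom $x$ is the induced subposet $$\mathrm{Sh}_x(P)=\bigl((P\setminus\{\hat 0,x\})\times\{x\}\bigr)\cup\bigl((x,\hat 1]\times\{\hat 0\}\bigr)\cup\{(\hat 0,\hat 0)\}$$ of $P\times[\hat 0,x]$. Write $\mathrm{Pyr}\,\Psi_P:=\Psi_{\mathrm{Pyr}(P)}$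 and $\mathrm{Sh}_x\Psi_P:=\Psi_{\mathrm{Sh}_x(P)}$. **Theorem.** Let $(W,S)$ be a Coxeter system with length function $l$, ordered by Bruhat order, and for $v\in W$ and $s\in S$ put $\sigma_s(v)=l(vs)-l(v)$. Every Bruhat interval $[x,y]$ has a cd-index $\Psi_{[x,y]}$. Let $u,w\in W$ and $s\in S$ be such that $u<us$, $w<ws$ and $u\le w$. (1) If $us\notin[u,w]$, then $\Psi_{[u,ws]}=\mathrm{Pyr}\,\Psi_{[u,w]}$ and $\Psi_{[us,ws]}=\Psi_{[u,w]}$. (2) If $us\in[u,w]$, then $$\begin{aligned} \Psi_{[u,ws]}&=\mathrm{Pyr}\,\Psi_{[u,w]}-\sum_{v\in(u,w):\,vs<v}\Psi_{[u,v]}\cdot d\cdot\Psi_{[v,w]}\\ &=\tfrac12\Bigl(\Psi_{[u,w]}\cdot c+c\cdot\Psi_{[u,w]}+\sum_{v\in(u,w)}\sigma_s(v)\,\Psi_{[u,v]}\cdot d\cdot\Psi_{[v,w]}\Bigr),\\ \Psi_{[us,ws]}&=\mathrm{Sh}_{us}\Psi_{[u,w]}-\sum_{v\in(us,w):\,vs<v}\Psi_{[us,v]}\cdot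 d\cdot\Psi_{[v,w]}\\ &=\Psi_{[u,w]}+\tfrac12\Bigl(\Psi_{[us,w]}\cdot c-c\cdot\Psi_{[us,w]}+\sum_{v\in(us,w)}\sigma_s(v)\,\Psi_{[us,v]}\cdot d\cdot\Psi_{[v,w]}\Bigr). \end{aligned}$$ -/

import Mathlib

/-! ### The `ab`-index of a finite graded poset -/

/-- Noncommutative `ab`-polynomials. The flag vectors below are integral; rational coefficients
only serve to write the factor one half. -/
abbrev ABPoly : Type := FreeAlgebra ℚ (Fin 2)

namespace ABPoly

noncomputable def a : ABPoly := FreeAlgebra.ι ℚ 0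

noncomputable def b : ABPoly := FreeAlgebra.ι ℚ 1

noncomputable def c : ABPoly := a + b

noncomputable def d : ABPoly := a * b + b * a

/-- The polynomials in `c` and `d` with integer coefficients. -/
noncomputable def cdPolynomials : Subring ABPoly := Subring.closure {c, d}

/-- The monomial `u₁ u₂ ⋯ uₙ` of `S ⊆ {1, …, n}`: `uᵢ = b` if `i ∈ S`, and `uᵢ = a` otherwise. -/
noncomputable def monomial (n : ℕ) (S : Finset ℕ) : ABPoly :=
  ((List.range n).map fun i => if i + 1 ∈ S then b else a).prod

end ABPoly

section Poset

variable (P : Type*) [PartialOrder P]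

variable {P} in
/-- The rank of an element of a finite graded poset: the length of a longest chain ending there. -/
noncomputable def posetRank (x : P) : ℕ := (Order.height x).toNat

/-- The rank of a finite graded poset: the largest rank of an element. -/
noncomputable def totalRank : ℕ := ⨆ x : P, posetRank x

/-- The flag f-vector of a finite graded poset with least and greatest element: the number of
chains that avoid these two elements and whose set of ranks is `S`. -/
noncomputable def flagF (S : Finset ℕ) : ℕ :=
  {C : Finset P | IsChain (· ≤ ·) (C : Set P) ∧ (∀ x ∈ C, ¬ IsBot x ∧ ¬ IsTop x) ∧
    C.image posetRank = S}.ncard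

/-- The flag h-vector. -/
noncomputable def flagH (S : Finset ℕ) : ℤ :=
  ∑ T ∈ S.powerset, (-1 : ℤ) ^ (S \ T).card * (flagF P T : ℤ)

/-- The `ab`-index of a finite graded poset of rank `n + 1` with least and greatest element. For a
poset that has a `cd`-index, this is the `cd`-index, written out in `a` and `b`. (A one-point poset
has rank `0`; its index is `1`.) -/
noncomputable def abIndex : ABPoly :=
  ∑ S ∈ (Finset.Icc 1 (totalRank P - 1)).powerset,
    flagH P S • ABPoly.monomial (totalRank P - 1) S

/-- The pyramid of a poset: its product with a two-element chain. -/
abbrev Pyr : Type _ := P × Fin 2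

variable {P} in
/-- The shaving of a poset with least element `0` at an atom `a`: the induced subposet
`((P ∖ {0, a}) × {a}) ∪ ((a, 1] × {0}) ∪ {(0, 0)}` of `P × [0, a]`. -/
abbrev Shaving (x : P) : Type _ :=
  {p : P × Set.Iic x //
    (¬ IsBot p.1 ∧ p.1 ≠ x ∧ (p.2 : P) = x) ∨
    (x < p.1 ∧ IsBot (p.2 : P)) ∨
    (IsBot p.1 ∧ IsBot (p.2 : P))}

end Poset

/-! ### Bruhat order -/

namespace CoxeterSystem

variable {B W : Type*} [Group W] {M : CoxeterMatrix B} (cs : CoxeterSystem M W)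

/-- Bruhat order through the subword property: every reduced word of `w` has a reduced subword
that represents `v`. -/
def BruhatLE (v w : W) : Prop :=
  ∀ ω : List B, cs.IsReduced ω → cs.wordProd ω = w →
    ∃ ω' : List B, ω'.Sublist ω ∧ cs.IsReduced ω' ∧ cs.wordProd ω' = v

def BruhatLT (v w : W) : Prop := cs.BruhatLE v w ∧ v ≠ w

theorem BruhatLE.refl (w : W) : cs.BruhatLE w w :=
  fun ω hω h => ⟨ω, List.Sublist.refl ω, hω, h⟩

variable {cs} in
theorem BruhatLE.trans {u v w : W} (h₁ : cs.BruhatLE u v) (h₂ : cs.BruhatLE v w) :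
    cs.BruhatLE u w := by
  intro ω hω h
  obtain ⟨ω', hs', hr', h'⟩ := h₂ ω hω h
  obtain ⟨ω'', hs'', hr'', h''⟩ := h₁ ω' hr' h'
  exact ⟨ω'', hs''.trans hs', hr'', h''⟩

variable {cs} in
theorem BruhatLE.length_le {v w : W} (h : cs.BruhatLE v w) : cs.length v ≤ cs.length w := by
  obtain ⟨ω, hω, rfl⟩ := cs.exists_isReduced w
  obtain ⟨ω', hs, hr, rfl⟩ := h ω hω rfl
  rw [hω.eq, hr.eq]
  exact hs.length_le

variable {cs} in
theorem BruhatLE.antisymm {v w : W} (h₁ : cs.BruhatLE v w) (h₂ : cs.BruhatLE w v) : v = w := by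
  have hl := h₂.length_le
  obtain ⟨ω, hω, rfl⟩ := cs.exists_isReduced w
  obtain ⟨ω', hs, hr, rfl⟩ := h₁ ω hω rfl
  rw [hω.eq, hr.eq] at hl
  rw [hs.eq_of_length_le hl]

/-- The closed interval `[u, w]` in Bruhat order. -/
def bruhatIcc (u w : W) : Set W := {v | cs.BruhatLE u v ∧ cs.BruhatLE v w}

/-- The open interval `(u, w)` in Bruhat order. -/
def bruhatIoo (u w : W) : Set W := {v | cs.BruhatLT u v ∧ cs.BruhatLT v w}

/-- The closed interval `[u, w]` as a poset. -/
instance bruhatIccPartialOrder (u w : W) : PartialOrder (cs.bruhatIcc u w) where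
  le x y := cs.BruhatLE x.1 y.1
  le_refl x := BruhatLE.refl cs x.1
  le_trans _ _ _ h₁ h₂ := h₁.trans h₂
  le_antisymm _ _ h₁ h₂ := Subtype.ext (h₁.antisymm h₂)

theorem finite_bruhatIoo (u w : W) : (cs.bruhatIoo u w).Finite := by
  obtain ⟨ω, hω, hw⟩ := cs.exists_isReduced w
  refine (List.finite_toSet (ω.sublists.map cs.wordProd)).subset ?_
  rintro v ⟨-, hv, -⟩
  obtain ⟨ω', hs, -, h⟩ := hv ω hω hw.symm
  exact List.mem_map.2 ⟨ω', List.mem_sublists.2 hs, h⟩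

/-- The elements of the open interval `(u, w)`. -/
noncomputable def bruhatIooFinset (u w : W) : Finset W := (cs.finite_bruhatIoo u w).toFinset

open scoped Classical in
/-- The elements `v` of the open interval `(u, w)` with `v * s < v`. -/
noncomputable def bruhatIooDescents (u w s : W) : Finset W :=
  {v ∈ cs.bruhatIooFinset u w | cs.BruhatLT (v * s) v}

/-- The `ab`-index (equivalently, the `cd`-index) of the Bruhat interval `[u, w]`. -/
noncomputable def bruhatIndex (u w : W) : ABPoly := abIndex (cs.bruhatIcc u w)

/-- The change of length `σ_s(v) = l(v s) - l(v)`. -/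
noncomputable def sigma (s v : W) : ℤ := (cs.length (v * s) : ℤ) - (cs.length v : ℤ)

end CoxeterSystem

/-! Expanding the flag h-vector turns Ψ_{[x,y]} into a sum over chains, with a factor b at each rank
that the chain meets and a − b at every other rank. Splitting off the largest element of a chain
gives the matrix equation Ψ = φ + ΨbΦ with Φ = φ, where φ(x,y) = (a−b)^{ρ(y)−ρ(x)−1} for x < y. It
is strictly triangular, so it determines Ψ (`abIndex_eq_of_recursion`), and a formula for Ψ is
proved by checking the recursion, an identity in a noncommutative ring. For u < w this yields Pyr Ψ
= bΨ + Ψa + Ψ·ab·Ψ (`IsIndexKernel.abIndex_pyr`), and the shaving at x adds to Ψ the term Ψa − aΨ +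
Ψ·ab·Ψ formed in row x (`IsIndexKernel.abIndex_shaving`).

For Bruhat order let J consist of the v ≤ w with v < vs, and split the recursion into blocks along J
and Js. The lifting property gives φ(vs,v's) = φ(v,v') and φ(v,v's) = δ + (a−b)φ(v,v'). With p, q,
r, t the blocks Ψ(v,v'), Ψ(v,v's), Ψ(vs,v'), Ψ(vs,v's), `block_identities` and
`eq_zero_of_block_recursion` give q = 1 + bp + pa + p·ab·p − q·ba·r and t = p + ra − ar + r·ab·p −
t·ba·r. In the two sums ascents contribute ab and descents −ba = ab − d. Hence the pyramid,
respectively the shaving, appears minus a sum of terms Ψ·d·Ψ over descents (`sum_ascentsBelow_sub`).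

Bruhat intervals are Eulerian, so bΨ + Ψa + Ψ·ab·Ψ is unchanged when a and b are exchanged;
averaging the two versions gives the forms with factor one half. For the cd-index, the derivation D
with a ↦ ba, b ↦ ab satisfies DΨ = bΨ − Ψb + Ψ·ab·Ψ. Thus the pyramid is DΨ + Ψc, and D preserves
integral cd-polynomials since Dc = d and Dd = cd; induction on length finishes. The lifting property
and the grading of Bruhat order are derived from strong exchange. -/

namespace CoxeterSystem

variable {B W : Type*} [Group W] {M : CoxeterMatrix B} (cs : CoxeterSystem M W)

open List

/-! ### The strong exchange property -/

open scoped Classical in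
/-- The action of a simple reflection on pairs of a group element and a parity. -/
noncomputable def parityStep (i : B) : (Function.End (W × ZMod 2))ᵐᵒᵖ :=
  -- In the opposite monoid the first letter of a word acts first.
  MulOpposite.op fun p =>
    (cs.simple i * p.1 * cs.simple i, p.2 + if p.1 = cs.simple i then 1 else 0)

open scoped Classical in
theorem prod_map_parityStep (ω : List B) (r : W) (z : ZMod 2) :
    (ω.map cs.parityStep).prod.unop (r, z) =
      ((cs.wordProd ω)⁻¹ * r * cs.wordProd ω, z + ((cs.leftInvSeq ω).count r : ZMod 2)) := by
  induction ω generalizing r z with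
  | nil => simp; rfl
  | cons i ω ih =>
    rw [List.map_cons, List.prod_cons, MulOpposite.unop_mul]
    change (ω.map cs.parityStep).prod.unop ((cs.parityStep i).unop (r, z)) = _
    have h1 : (cs.parityStep i).unop (r, z) =
      (cs.simple i * r * cs.simple i, z + if r = cs.simple i then 1 else 0) := rfl
    rw [h1, ih, leftInvSeq, List.count_cons, wordProd_cons]
    have h2 : (List.map (⇑(MulAut.conj (cs.simple i))) (cs.leftInvSeq ω)).count r =
        (cs.leftInvSeq ω).count (cs.simple i * r * cs.simple i) := by
      have : r = MulAut.conj (cs.simple i) (cs.simple i * r * cs.simple i) := by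
        simp [MulAut.conj_apply, mul_assoc]
      conv_lhs => rw [this]
      exact List.count_map_of_injective _ _ (MulAut.conj (cs.simple i)).injective _
    rw [h2]
    refine Prod.ext ?_ ?_
    · simp [mul_assoc]
    · by_cases h : r = cs.simple i
      · simp [h]; ring
      · simp [h, Ne.symm h]

theorem prod_map_alternatingWord {G : Type*} [Monoid G] (f : B → G) (i j : B) (m : ℕ) :
    ((alternatingWord i j (2 * m)).map f).prod = (f i * f j) ^ m := by
  induction m with
  | zero => simp [alternatingWord]
  | succ m ih =>
    rw [show 2 * (m + 1) = 2 * m + 1 + 1 by ring, alternatingWord_succ', alternatingWord_succ']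
    simp [ih, pow_succ', mul_assoc]

theorem wordProd_alternatingWord_add (i j : B) (k : ℕ) :
    cs.wordProd (alternatingWord i j (2 * (M i j + k) + 1)) =
      cs.wordProd (alternatingWord i j (2 * k + 1)) := by
  rw [prod_alternatingWord_eq_mul_pow, prod_alternatingWord_eq_mul_pow]
  have h1 : (2 * (M i j + k) + 1) / 2 = M i j + k := by omega
  have h2 : (2 * k + 1) / 2 = k := by omega
  have h3 : ¬ Even (2 * (M i j + k) + 1) := by simp
  have h4 : ¬ Even (2 * k + 1) := by simp
  simp only [h1, h2, h3, h4, if_false, pow_add, simple_mul_simple_pow, one_mul]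

/-- The entries number k and m + k are alternating words of lengths 2k+1 and 2(m+k)+1, which agree
because the m-th power of the product of the two generators is 1. So every reflection occurs an even
number of times, and the parity action respects the Coxeter relations. -/
theorem leftInvSeq_alternatingWord (i j : B) :
    ∃ L, cs.leftInvSeq (alternatingWord i j (2 * M i j)) = L ++ L := by
  set m := M i j with hm
  have hlen : (cs.leftInvSeq (alternatingWord i j (2 * m))).length = 2 * m := by simp
  refine ⟨(cs.leftInvSeq (alternatingWord i j (2 * m))).take m, ?_⟩
  conv_lhs => rw [← List.take_append_drop m (cs.leftInvSeq (alternatingWord i j (2 * m)))]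
  congr 1
  apply List.ext_getElem
  · simp; omega
  · intro k h1 h2
    simp only [List.getElem_drop, List.getElem_take]
    have hk : k < m := by simp at h2; omega
    rw [getElem_leftInvSeq_alternatingWord _ _ _ _ _ (by omega),
      getElem_leftInvSeq_alternatingWord _ _ _ _ _ (by omega)]
    have := cs.wordProd_alternatingWord_add j i k
    rwa [M.symmetric j i, ← hm] at this

open scoped Classical in
theorem isLiftable_parityStep : M.IsLiftable cs.parityStep := by
  intro i j
  rw [← prod_map_alternatingWord]
  apply MulOpposite.unop_injective
  funext p
  obtain ⟨r, z⟩ := p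
  rw [prod_map_parityStep]
  obtain ⟨L, hL⟩ := cs.leftInvSeq_alternatingWord i j
  have h1 : cs.wordProd (alternatingWord i j (2 * M i j)) = 1 := by
    rw [wordProd, prod_map_alternatingWord, simple_mul_simple_pow]
  rw [hL, h1, List.count_append]
  push_cast
  rw [CharTwo.add_self_eq_zero]
  simp only [inv_one, one_mul, mul_one, add_zero]
  rfl

/-- The action of the group on pairs of a group element and a parity. -/
noncomputable def parityHom : W →* (Function.End (W × ZMod 2))ᵐᵒᵖ :=
  cs.lift ⟨cs.parityStep, cs.isLiftable_parityStep⟩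

theorem parityHom_wordProd (ω : List B) :
    cs.parityHom (cs.wordProd ω) = (ω.map cs.parityStep).prod := by
  rw [wordProd, map_list_prod, List.map_map]
  congr 2
  funext i
  exact cs.lift_apply_simple _ i

/-- The parity of the number of occurrences of `r` in the left inversion sequence of a word
for `w`. -/
noncomputable def inversionParity (w r : W) : ZMod 2 := ((cs.parityHom w).unop (r, 0)).2

open scoped Classical in
theorem inversionParity_wordProd (ω : List B) (r : W) :
    cs.inversionParity (cs.wordProd ω) r = ((cs.leftInvSeq ω).count r : ZMod 2) := by
  rw [inversionParity, parityHom_wordProd, prod_map_parityStep, zero_add]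

theorem inversionParity_mul (v w r : W) :
    cs.inversionParity (v * w) r = cs.inversionParity v r + cs.inversionParity w (v⁻¹ * r * v) := by
  classical
  obtain ⟨α, rfl⟩ := cs.wordProd_surjective v
  obtain ⟨β, rfl⟩ := cs.wordProd_surjective w
  rw [inversionParity, map_mul, MulOpposite.unop_mul]
  change ((cs.parityHom _).unop ((cs.parityHom _).unop (r, 0))).2 = _
  rw [parityHom_wordProd, parityHom_wordProd, prod_map_parityStep, prod_map_parityStep,
    inversionParity_wordProd, inversionParity_wordProd]
  simp

theorem inversionParity_simple (i : B) : cs.inversionParity (cs.simple i) (cs.simple i) = 1 := by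
  classical
  have := cs.inversionParity_wordProd [i] (cs.simple i)
  simpa using this

theorem inversionParity_one (r : W) : cs.inversionParity 1 r = 0 := by
  classical
  have := cs.inversionParity_wordProd [] r
  simpa using this

/-- For t = w s w⁻¹ the cocycle rule leaves the contribution 1 of s, since those of w and w⁻¹ add up
to the parity for w w⁻¹ = 1. -/
theorem IsReflection.inversionParity_self {cs : CoxeterSystem M W} {t : W}
    (ht : cs.IsReflection t) : cs.inversionParity t t = 1 := by
  obtain ⟨w, i, rfl⟩ := ht
  have h := cs.inversionParity_mul w w⁻¹ (w * cs.simple i * w⁻¹)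
  rw [mul_inv_cancel, inversionParity_one] at h
  rw [mul_assoc w, inversionParity_mul, inversionParity_mul, ← mul_assoc w]
  have h1 : w⁻¹ * (w * cs.simple i * w⁻¹) * w = cs.simple i := by group
  rw [h1] at h ⊢
  rw [inversionParity_simple]
  have h2 : (cs.simple i)⁻¹ * cs.simple i * cs.simple i = cs.simple i := by group
  rw [h2]
  linear_combination -h

/-- Strong exchange: a left inversion of `w` occurs in the left inversion sequence of every word
for `w`. -/
theorem mem_leftInvSeq_of_isLeftInversion (ω : List B) {t : W}
    (h : cs.IsLeftInversion (cs.wordProd ω) t) : t ∈ cs.leftInvSeq ω := by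
  classical
  by_contra hmem
  have h0 : cs.inversionParity (cs.wordProd ω) t = 0 := by
    rw [inversionParity_wordProd, List.count_eq_zero_of_not_mem hmem, Nat.cast_zero]
  -- An even parity of t for w means an odd one for tw. Then t is an inversion of tw as well, which
  -- makes w shorter than tw, against the assumption.
  have h1 : cs.inversionParity (t * cs.wordProd ω) t = 1 := by
    rw [inversionParity_mul, h.1.inversionParity_self, h.1.inv, mul_assoc, h.1.mul_self, mul_one,
      h0, add_zero]
  obtain ⟨τ, hτ, hτw⟩ := cs.exists_isReduced (t * cs.wordProd ω)
  have h2 : t ∈ cs.leftInvSeq τ := by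
    by_contra hn
    rw [hτw, inversionParity_wordProd, List.count_eq_zero_of_not_mem hn] at h1
    simp at h1
  have h3 := (cs.isLeftInversion_of_mem_leftInvSeq hτ h2).2
  rw [← hτw, ← mul_assoc, h.1.mul_self, one_mul] at h3
  exact absurd h3 (not_lt.2 h.2.le)

/-- Strong exchange: a word for `w` becomes a word for `w * t` by dropping one letter. -/
theorem exists_eraseIdx_of_length_mul_lt (ω : List B) {t : W} (ht : cs.IsReflection t)
    (h : cs.length (cs.wordProd ω * t) < cs.length (cs.wordProd ω)) :
    ∃ j < ω.length, cs.wordProd (ω.eraseIdx j) = cs.wordProd ω * t := by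
  have h1 : cs.IsLeftInversion (cs.wordProd ω) (cs.wordProd ω * t * (cs.wordProd ω)⁻¹) :=
    ⟨ht.conj _, by simpa [mul_assoc] using h⟩
  obtain ⟨j, hj, hjt⟩ := List.mem_iff_getElem.1 (cs.mem_leftInvSeq_of_isLeftInversion ω h1)
  refine ⟨j, by simpa using hj, ?_⟩
  rw [← getD_leftInvSeq_mul_wordProd, List.getD_eq_getElem _ _ hj, hjt]
  simp [mul_assoc]

end CoxeterSystem

namespace CoxeterSystem

variable {B W : Type*} [Group W] {M : CoxeterMatrix B} (cs : CoxeterSystem M W)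

/-! ### Bruhat order -/

/-- Every word contains a reduced word for the same element. -/
theorem exists_isReduced_sublist (ω : List B) :
    ∃ τ : List B, τ.Sublist ω ∧ cs.IsReduced τ ∧ cs.wordProd τ = cs.wordProd ω := by
  induction ω using List.reverseRecOn with
  | nil => exact ⟨[], List.Sublist.refl _, by simp [IsReduced], rfl⟩
  | append_singleton ω i ih =>
    obtain ⟨τ, hs, hr, hp⟩ := ih
    have hw : cs.wordProd (ω ++ [i]) = cs.wordProd τ * cs.simple i := by
      rw [wordProd_append, wordProd_singleton, hp]
    rcases cs.length_mul_simple (cs.wordProd τ) i with h | h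
    · refine ⟨τ ++ [i], hs.append (List.Sublist.refl _), ?_, ?_⟩
      · rw [IsReduced, wordProd_append, wordProd_singleton, h, hr.eq]
        simp
      · rw [wordProd_append, wordProd_singleton, hp, hw, hp]
    · obtain ⟨j, hj, hjp⟩ := cs.exists_eraseIdx_of_length_mul_lt τ (cs.isReflection_simple i)
        (by omega)
      refine ⟨τ.eraseIdx j, ((List.eraseIdx_sublist τ j).trans hs).trans
        (List.sublist_append_left _ _), ?_, ?_⟩
      · rw [IsReduced, hjp]
        have := List.length_eraseIdx_add_one hj
        have := hr.eq
        omega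
      · rw [hjp, hw]

/-- `w` is the product of `v` with a reflection and is longer than `v`. -/
def ReflectionStep (v w : W) : Prop :=
  ∃ t, cs.IsReflection t ∧ w = v * t ∧ cs.length v < cs.length w

variable {cs}

theorem ReflectionStep.bruhatLE {v w : W} (h : cs.ReflectionStep v w) : cs.BruhatLE v w := by
  obtain ⟨t, ht, rfl, hl⟩ := h
  intro ω hω hw
  have hv : cs.wordProd ω * t = v := by rw [hw, mul_assoc, ht.mul_self, mul_one]
  obtain ⟨j, -, hj⟩ := cs.exists_eraseIdx_of_length_mul_lt ω ht (by rw [hv, hw]; exact hl)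
  obtain ⟨τ, hs, hr, hp⟩ := cs.exists_isReduced_sublist (ω.eraseIdx j)
  exact ⟨τ, hs.trans (List.eraseIdx_sublist _ _), hr, by rw [hp, hj, hv]⟩

/-- One has ws = us · (sts). If this product were shorter than us, exchange would delete a letter
from a word of u followed by s: deleting a letter of u makes w shorter than u, and deleting s forces
t = s. -/
theorem ReflectionStep.mul_simple {u w : W} (h : cs.ReflectionStep u w) (i : B) :
    u * cs.simple i = w ∨ cs.ReflectionStep (u * cs.simple i) (w * cs.simple i) := by
  obtain ⟨t, ht, rfl, hl⟩ := h
  by_cases hti : t = cs.simple i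
  · exact Or.inl (by rw [hti])
  right
  have ht' : cs.IsReflection (cs.simple i * t * cs.simple i) := by
    simpa using ht.conj (cs.simple i)
  have hws : u * t * cs.simple i = u * cs.simple i * (cs.simple i * t * cs.simple i) := by
    simp [mul_assoc]
  refine ⟨_, ht', hws, ?_⟩
  by_contra hlt
  have hne := ht'.length_mul_left_ne (u * cs.simple i)
  rw [← hws] at hne
  obtain ⟨ρ, hρ, hρu⟩ := cs.exists_isReduced u
  -- This word need not be reduced; strong exchange holds for every word.
  have hp : cs.wordProd (ρ ++ [i]) = u * cs.simple i := by
    rw [wordProd_append, wordProd_singleton, hρu]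
  obtain ⟨j, hj, hje⟩ := cs.exists_eraseIdx_of_length_mul_lt (ρ ++ [i]) ht'
    (by rw [hp, ← hws]; omega)
  rw [hp, ← hws] at hje
  have h1 := cs.length_mul_simple u i
  have h2 := cs.length_mul_simple (u * t) i
  have hlen := hρ.eq
  rw [← hρu] at hlen
  rcases Nat.lt_or_ge j ρ.length with hjl | hjl
  · rw [List.eraseIdx_append_of_lt_length hjl, wordProd_append, wordProd_singleton] at hje
    have h3 := mul_right_cancel hje
    have h4 := cs.length_wordProd_le (ρ.eraseIdx j)
    rw [h3] at h4
    have := List.length_eraseIdx_add_one hjl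
    omega
  · have hj' : j = ρ.length := by simp at hj; omega
    rw [List.eraseIdx_append_of_length_le hjl, hj'] at hje
    simp only [Nat.sub_self, List.eraseIdx_cons_zero, List.append_nil] at hje
    rw [← hρu] at hje
    apply hti
    have : u * (t * cs.simple i) = u * 1 := by rw [← mul_assoc, ← hje, mul_one]
    have := mul_left_cancel this
    calc t = t * cs.simple i * cs.simple i := by simp
      _ = cs.simple i := by rw [this, one_mul]

theorem reflectionStep_simple {w : W} {i : B} (h : cs.length (w * cs.simple i) < cs.length w) :
    cs.ReflectionStep (w * cs.simple i) w :=
  ⟨cs.simple i, cs.isReflection_simple i, by simp, h⟩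

theorem reflTransGen_mul_simple {u w : W} (h : Relation.ReflTransGen cs.ReflectionStep u w)
    (i : B) :
    Relation.ReflTransGen cs.ReflectionStep (u * cs.simple i) w ∨
      Relation.ReflTransGen cs.ReflectionStep (u * cs.simple i) (w * cs.simple i) := by
  induction h using Relation.ReflTransGen.head_induction_on with
  | refl => exact Or.inr Relation.ReflTransGen.refl
  | head h1 h2 ih =>
    rcases h1.mul_simple i with h | h
    · exact Or.inl (h ▸ h2)
    · exact ih.imp (fun k => k.head h) (fun k => k.head h)

theorem reflTransGen_of_sublist {τ ω : List B} (hs : τ.Sublist ω) (hω : cs.IsReduced ω) :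
    Relation.ReflTransGen cs.ReflectionStep (cs.wordProd τ) (cs.wordProd ω) := by
  induction ω using List.reverseRecOn generalizing τ with
  | nil => rw [List.sublist_nil.1 hs]
  | append_singleton ω i ih =>
    have hω' : cs.IsReduced ω := by simpa using hω.take ω.length
    have hstep : cs.ReflectionStep (cs.wordProd ω) (cs.wordProd (ω ++ [i])) :=
      ⟨cs.simple i, cs.isReflection_simple i, by rw [wordProd_append, wordProd_singleton],
        by rw [hω.eq, hω'.eq]; simp⟩
    obtain ⟨τ₁, τ₂, rfl, h1, h2⟩ := List.sublist_append_iff.1 hs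
    have ih1 := ih h1 hω'
    rcases List.sublist_singleton.1 h2 with rfl | rfl
    · simpa using ih1.tail hstep
    · rw [wordProd_append _ τ₁, wordProd_singleton]
      rcases reflTransGen_mul_simple ih1 i with h | h
      · exact h.tail hstep
      · rwa [wordProd_append, wordProd_singleton]

/-- The description by reflections mentions no word, so a subword of a single reduced word of w
already suffices for the relation, although the definition asks for all of them. -/
theorem bruhatLE_iff_reflTransGen {v w : W} :
    cs.BruhatLE v w ↔ Relation.ReflTransGen cs.ReflectionStep v w := by
  constructor
  · intro h
    obtain ⟨ω, hω, rfl⟩ := cs.exists_isReduced w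
    obtain ⟨τ, hs, -, rfl⟩ := h ω hω rfl
    exact reflTransGen_of_sublist hs hω
  · intro h
    induction h with
    | refl => exact BruhatLE.refl cs v
    | tail _ h ih => exact ih.trans h.bruhatLE

theorem bruhatLE_of_sublist {τ ω : List B} (hs : τ.Sublist ω) (hω : cs.IsReduced ω) :
    cs.BruhatLE (cs.wordProd τ) (cs.wordProd ω) :=
  bruhatLE_iff_reflTransGen.2 (reflTransGen_of_sublist hs hω)

theorem BruhatLE.length_lt {v w : W} (h : cs.BruhatLE v w) (hne : v ≠ w) :
    cs.length v < cs.length w := by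
  obtain ⟨ω, hω, rfl⟩ := cs.exists_isReduced w
  obtain ⟨τ, hs, hr, rfl⟩ := h ω hω rfl
  rw [hω.eq, hr.eq]
  refine lt_of_le_of_ne hs.length_le fun he => hne ?_
  rw [hs.eq_of_length he]

theorem mul_simple_bruhatLE {w : W} {i : B} (h : cs.length (w * cs.simple i) < cs.length w) :
    cs.BruhatLE (w * cs.simple i) w :=
  (reflectionStep_simple h).bruhatLE

theorem bruhatLE_mul_simple {w : W} {i : B} (h : cs.length w < cs.length (w * cs.simple i)) :
    cs.BruhatLE w (w * cs.simple i) := by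
  simpa using mul_simple_bruhatLE (cs := cs) (w := w * cs.simple i) (i := i) (by simpa using h)

theorem BruhatLE.mul_simple_le {v w : W} (h : cs.BruhatLE v w) {i : B}
    (hw : cs.length (w * cs.simple i) < cs.length w) : cs.BruhatLE (v * cs.simple i) w := by
  rcases reflTransGen_mul_simple (bruhatLE_iff_reflTransGen.1 h) i with h | h
  · exact bruhatLE_iff_reflTransGen.2 h
  · exact (bruhatLE_iff_reflTransGen.2 h).trans (mul_simple_bruhatLE hw)

theorem BruhatLE.mul_simple_le_mul_simple {v w : W} (h : cs.BruhatLE v w) {i : B}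
    (hw : cs.length w < cs.length (w * cs.simple i)) :
    cs.BruhatLE (v * cs.simple i) (w * cs.simple i) :=
  BruhatLE.mul_simple_le (h.trans (bruhatLE_mul_simple hw)) (by simpa using hw)

/-- The lifting property: take a reduced word of ws that ends in s. A reduced subword for v either
avoids the last letter or uses it. -/
theorem BruhatLE.le_or_mul_simple_le {v w : W} {i : B} (h : cs.BruhatLE v (w * cs.simple i))
    (hw : cs.length w < cs.length (w * cs.simple i)) :
    cs.BruhatLE v w ∨
      cs.BruhatLE (v * cs.simple i) w ∧ cs.length (v * cs.simple i) < cs.length v := by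
  obtain ⟨ω, hω, rfl⟩ := cs.exists_isReduced w
  have hω' : cs.IsReduced (ω ++ [i]) := by
    rw [IsReduced, wordProd_append, wordProd_singleton]
    rcases cs.length_mul_simple (cs.wordProd ω) i with h | h
    · rw [h, hω.eq]; simp
    · omega
  obtain ⟨τ, hs, hr, rfl⟩ := h _ hω' (by rw [wordProd_append, wordProd_singleton])
  obtain ⟨τ₁, τ₂, rfl, h1, h2⟩ := List.sublist_append_iff.1 hs
  rcases List.sublist_singleton.1 h2 with rfl | rfl
  · exact Or.inl (by simpa using bruhatLE_of_sublist h1 hω)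
  · right
    have h3 : cs.wordProd (τ₁ ++ [i]) * cs.simple i = cs.wordProd τ₁ := by
      simp [wordProd_append]
    rw [h3, hr.eq]
    refine ⟨bruhatLE_of_sublist h1 hω, ?_⟩
    have := cs.length_wordProd_le τ₁
    simp
    omega

theorem BruhatLE.of_le_mul_simple {v w : W} {i : B} (h : cs.BruhatLE v (w * cs.simple i))
    (hw : cs.length w < cs.length (w * cs.simple i))
    (hv : cs.length v < cs.length (v * cs.simple i)) : cs.BruhatLE v w := by
  rcases h.le_or_mul_simple_le hw with h | ⟨-, h⟩
  · exact h
  · omega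

theorem BruhatLE.mul_simple_le_of_le_mul_simple {v w : W} {i : B}
    (h : cs.BruhatLE v (w * cs.simple i)) (hw : cs.length w < cs.length (w * cs.simple i))
    (hv : cs.length (v * cs.simple i) < cs.length v) : cs.BruhatLE (v * cs.simple i) w := by
  rcases h.le_or_mul_simple_le hw with h | ⟨h, -⟩
  · exact (mul_simple_bruhatLE hv).trans h
  · exact h

theorem length_lt_mul_simple_or (w : W) (i : B) :
    cs.length w < cs.length (w * cs.simple i) ∨ cs.length (w * cs.simple i) < cs.length w := by
  rcases cs.length_mul_simple w i with h | h <;> omega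

theorem bruhatLT_mul_simple_iff {w : W} {i : B} :
    cs.BruhatLT w (w * cs.simple i) ↔ cs.length w < cs.length (w * cs.simple i) := by
  refine ⟨fun h => h.1.length_lt h.2, fun h => ⟨bruhatLE_mul_simple h, fun he => ?_⟩⟩
  rw [← he] at h
  exact lt_irrefl _ h

theorem mul_simple_bruhatLT_iff {w : W} {i : B} :
    cs.BruhatLT (w * cs.simple i) w ↔ cs.length (w * cs.simple i) < cs.length w := by
  simpa using bruhatLT_mul_simple_iff (cs := cs) (w := w * cs.simple i) (i := i)

/-- Bruhat order is graded by the length. -/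
theorem BruhatLE.exists_coatom {u w : W} (h : cs.BruhatLE u w) (hne : u ≠ w) :
    ∃ z, cs.BruhatLE u z ∧ cs.BruhatLE z w ∧ cs.length z + 1 = cs.length w := by
  induction hn : cs.length w using Nat.strong_induction_on generalizing u w with
  | _ n ih =>
    subst hn
    have hw1 : w ≠ 1 := by
      rintro rfl
      have := h.length_lt hne
      simp at this
    obtain ⟨i, hi⟩ := cs.exists_rightDescent_of_ne_one hw1
    obtain ⟨w, rfl⟩ : ∃ w', w = w' * cs.simple i := ⟨w * cs.simple i, by simp⟩
    have hi : cs.length w < cs.length (w * cs.simple i) := by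
      simpa [IsRightDescent] using hi
    have hlw : cs.length w + 1 = cs.length (w * cs.simple i) := by
      rcases cs.length_mul_simple w i with h | h <;> omega
    rcases h.le_or_mul_simple_le hi with h1 | ⟨h1, hu⟩
    · exact ⟨w, h1, bruhatLE_mul_simple hi, hlw⟩
    · have hne' : u * cs.simple i ≠ w := by
        rintro rfl
        simp at hne
      obtain ⟨z, hz1, hz2, hz3⟩ := ih _ hi h1 hne' rfl
      -- If z goes up under s, then zs is the coatom sought. Otherwise lifting puts u itself below
      -- z, hence below w, and w serves.
      rcases length_lt_mul_simple_or (cs := cs) z i with hz | hz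
      · refine ⟨z * cs.simple i, by simpa using hz1.mul_simple_le_mul_simple hz,
          hz2.mul_simple_le_mul_simple hi, ?_⟩
        rcases cs.length_mul_simple z i with h | h <;> omega
      · have := hz1.mul_simple_le hz
        rw [simple_mul_simple_cancel_right] at this
        exact ⟨w, this.trans hz2, bruhatLE_mul_simple hi, hlw⟩

variable (cs)

theorem finite_bruhatIcc (u w : W) : (cs.bruhatIcc u w).Finite := by
  refine ((cs.finite_bruhatIoo u w).union (Set.toFinite {u, w})).subset ?_
  rintro v ⟨h1, h2⟩
  by_cases hu : u = v
  · exact Or.inr (by simp [hu])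
  by_cases hw : v = w
  · exact Or.inr (by simp [hw])
  exact Or.inl ⟨⟨h1, hu⟩, ⟨h2, hw⟩⟩

end CoxeterSystem

open ABPoly

/-! ### The `ab`-index as a sum over chains -/

namespace ABPoly

/-- The product `u₁ ⋯ uₙ` with `uᵢ = b` for `i ∈ T` and `uᵢ = a - b` otherwise. -/
noncomputable def weight (n : ℕ) (T : Finset ℕ) : ABPoly :=
  ((List.range n).map fun i => if i + 1 ∈ T then b else a - b).prod

theorem weight_succ (n : ℕ) (T : Finset ℕ) :
    weight (n + 1) T = weight n T * if n + 1 ∈ T then b else a - b := by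
  simp [weight, List.range_succ]

theorem monomial_succ (n : ℕ) (T : Finset ℕ) :
    monomial (n + 1) T = monomial n T * if n + 1 ∈ T then b else a := by
  simp [monomial, List.range_succ]

theorem weight_congr {n : ℕ} {S T : Finset ℕ} (h : ∀ i ∈ Finset.Icc 1 n, i ∈ S ↔ i ∈ T) :
    weight n S = weight n T := by
  unfold weight
  congr 1
  apply List.map_congr_left
  intro i hi
  have := h (i + 1) (by simp at hi ⊢; omega)
  simp only [this]

theorem monomial_congr {n : ℕ} {S T : Finset ℕ} (h : ∀ i ∈ Finset.Icc 1 n, i ∈ S ↔ i ∈ T) :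
    monomial n S = monomial n T := by
  unfold monomial
  congr 1
  apply List.map_congr_left
  intro i hi
  have := h (i + 1) (by simp at hi ⊢; omega)
  simp only [this]

theorem weight_add (n k : ℕ) (T : Finset ℕ) (h : ∀ i ∈ T, i ≤ n) :
    weight (n + k) T = weight n T * (a - b) ^ k := by
  induction k with
  | zero => simp
  | succ k ih =>
    rw [← add_assoc, weight_succ, ih, if_neg, pow_succ, mul_assoc]
    intro hmem
    have := h _ hmem
    omega

theorem weight_empty (n : ℕ) : weight n ∅ = (a - b) ^ n := by
  simp [weight]

theorem weight_insert {n r : ℕ} {T : Finset ℕ} (hr : 1 ≤ r) (hrn : r ≤ n) (hT : ∀ i ∈ T, i < r) :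
    weight n (insert r T) = weight (r - 1) T * b * (a - b) ^ (n - r) := by
  obtain ⟨k, rfl⟩ := Nat.exists_eq_add_of_le hrn
  obtain ⟨r, rfl⟩ := Nat.exists_eq_add_of_le' hr
  rw [weight_add _ _ _ (by simpa using fun i hi => (hT i hi).le), weight_succ,
    if_pos (Finset.mem_insert_self _ _)]
  simp only [Nat.add_sub_cancel, Nat.add_sub_cancel_left]
  rw [weight_congr (S := insert (r + 1) T) (T := T)]
  intro i hi
  simp at hi ⊢
  omega

open scoped Classical in
-- Each factor a − b is expanded: S collects the positions where b is chosen, at the cost of a sign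
-- for each one outside T. Only positions up to n count, so T may be arbitrary beyond.
theorem weight_eq_sum (n : ℕ) (T : Finset ℕ) :
    weight n T = ∑ S ∈ (Finset.Icc 1 n).powerset,
      (if ∀ i ∈ Finset.Icc 1 n, i ∈ T → i ∈ S then (-1 : ℤ) ^ (S \ T).card else 0) •
        monomial n S := by
  induction n with
  | zero => simp [weight, monomial]
  | succ n ih =>
    have hI : Finset.Icc 1 (n + 1) = insert (n + 1) (Finset.Icc 1 n) := by
      ext i; simp; omega
    have hn : n + 1 ∉ Finset.Icc 1 n := by simp
    rw [hI, Finset.sum_powerset_insert hn, weight_succ, ih, Finset.sum_mul,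
      ← Finset.sum_add_distrib]
    refine Finset.sum_congr rfl fun S hS => ?_
    rw [Finset.mem_powerset] at hS
    have hnS : n + 1 ∉ S := fun h => hn (hS h)
    rw [monomial_succ, monomial_succ, if_neg hnS, if_pos (Finset.mem_insert_self _ _),
      monomial_congr (n := n) (S := insert (n + 1) S) (T := S)
        (fun i hi => by simp at hi ⊢; omega)]
    have h2 : (∀ i ∈ insert (n + 1) (Finset.Icc 1 n), i ∈ T → i ∈ insert (n + 1) S) ↔
        ∀ i ∈ Finset.Icc 1 n, i ∈ T → i ∈ S := by
      constructor
      · intro h i hi hiT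
        rcases Finset.mem_insert.1 (h i (Finset.mem_insert_of_mem hi) hiT) with rfl | h
        · exact absurd hi hn
        · exact h
      · intro h i hi hiT
        rcases Finset.mem_insert.1 hi with rfl | hi
        · exact Finset.mem_insert_self _ _
        · exact Finset.mem_insert_of_mem (h i hi hiT)
    by_cases hT : n + 1 ∈ T
    · have h1 : ¬ ∀ i ∈ insert (n + 1) (Finset.Icc 1 n), i ∈ T → i ∈ S :=
        fun h => hnS (h _ (Finset.mem_insert_self _ _) hT)
      rw [if_neg h1, if_pos hT, Finset.insert_sdiff_of_mem _ hT]
      simp only [h2, zero_smul, zero_add, smul_mul_assoc]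
    · have h1 : (∀ i ∈ insert (n + 1) (Finset.Icc 1 n), i ∈ T → i ∈ S) ↔
          ∀ i ∈ Finset.Icc 1 n, i ∈ T → i ∈ S := by
        constructor
        · exact fun h i hi => h i (Finset.mem_insert_of_mem hi)
        · intro h i hi hiT
          rcases Finset.mem_insert.1 hi with rfl | hi
          · exact absurd hiT hT
          · exact h i hi hiT
      rw [if_neg hT, Finset.insert_sdiff_of_notMem _ hT, Finset.card_insert_of_notMem
        (by simp [hnS])]
      simp only [h1, h2]
      split_ifs
      · rw [pow_succ, mul_neg_one, neg_smul, smul_mul_assoc, mul_sub, smul_sub]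
        abel
      · simp

end ABPoly

section Chains

variable {P : Type*} [PartialOrder P]

/-- Strict monotonicity bounds the height by ρ, and the predecessors attain the bound. -/
theorem posetRank_eq (ρ : P → ℕ) (hρ : StrictMono ρ)
    (hc : ∀ x, ρ x ≠ 0 → ∃ y < x, ρ y + 1 = ρ x) : posetRank (P := P) = ρ := by
  have key : ∀ n x, ρ x = n → Order.height x = n := by
    intro n
    induction n using Nat.strong_induction_on with
    | _ n ih =>
      rintro x rfl
      rw [Order.height_eq_iSup_lt_height]
      apply le_antisymm
      · refine iSup₂_le fun y hy => ?_
        rw [ih _ (hρ hy) y rfl]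
        exact_mod_cast hρ hy
      · by_cases h0 : ρ x = 0
        · simp [h0]
        · obtain ⟨y, hy, hyx⟩ := hc x h0
          rw [← hyx]
          push_cast
          rw [← ih _ (hρ hy) y rfl]
          exact le_iSup₂_of_le y hy le_rfl
  funext x
  rw [posetRank, key _ x rfl, ENat.toNat_natCast]

theorem totalRank_eq {ρ : P → ℕ} (hρ : StrictMono ρ) (h : posetRank (P := P) = ρ) {top : P}
    (htop : IsTop top) : totalRank P = ρ top := by
  rw [totalRank, h]
  apply le_antisymm
  · have : Nonempty P := ⟨top⟩
    exact ciSup_le fun x => hρ.monotone (htop x)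
  · exact le_ciSup (f := ρ) ⟨ρ top, by rintro _ ⟨x, rfl⟩; exact hρ.monotone (htop x)⟩ top

variable [Fintype P]

open scoped Classical in
/-- The chains of the open interval `(x, y)`. -/
noncomputable def openChains (x y : P) : Finset (Finset P) :=
  {C | IsChain (· ≤ ·) (C : Set P) ∧ ∀ z ∈ C, x < z ∧ z < y}

theorem mem_openChains {x y : P} {C : Finset P} :
    C ∈ openChains x y ↔ IsChain (· ≤ ·) (C : Set P) ∧ ∀ z ∈ C, x < z ∧ z < y := by
  simp [openChains]

/-- The `ab`-index of `[x, y]` as a sum over chains, for the rank function `ρ`. -/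
noncomputable def chainSum (ρ : P → ℕ) (x y : P) : ABPoly :=
  ∑ C ∈ openChains x y, weight (ρ y - ρ x - 1) (C.image fun z => ρ z - ρ x)

open scoped Classical in
/-- The contribution of the empty chain. -/
noncomputable def rankKernel {P : Type*} [PartialOrder P] (ρ : P → ℕ) : Matrix P P ABPoly :=
  Matrix.of fun x y => if x < y then (a - b) ^ (ρ y - ρ x - 1) else 0

theorem rankKernel_of_lt {P : Type*} [PartialOrder P] (ρ : P → ℕ) {x y : P} (h : x < y) :
    rankKernel ρ x y = (a - b) ^ (ρ y - ρ x - 1) := by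
  simp [rankKernel, h]

theorem rankKernel_of_not_lt {P : Type*} [PartialOrder P] (ρ : P → ℕ) {x y : P} (h : ¬ x < y) :
    rankKernel ρ x y = 0 := by
  simp [rankKernel, h]

open scoped Classical in
-- A nonempty chain is its largest element z together with a chain of (x, z). The rank of z gives
-- the factor b, and the ranks above it, which the chain misses, give the kernel from z to y.
theorem chainSum_eq (ρ : P → ℕ) (hρ : StrictMono ρ) {x y : P} (hxy : x < y) :
    chainSum ρ x y = rankKernel ρ x y +
      ∑ z with x < z, chainSum ρ x z * b * rankKernel ρ z y := by
  have h0 : ∅ ∈ openChains x y := by simp [mem_openChains]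
  rw [chainSum, ← Finset.add_sum_erase _ _ h0, Finset.image_empty, weight_empty,
    rankKernel_of_lt ρ hxy]
  congr 1
  have h1 : ∑ z with x < z, chainSum ρ x z * b * rankKernel ρ z y =
      ∑ z with x < z ∧ z < y, chainSum ρ x z * b * rankKernel ρ z y := by
    symm
    apply Finset.sum_subset
    · intro z; simp; tauto
    · intro z hz hz'
      rw [rankKernel_of_not_lt, mul_zero]
      simp at hz hz'
      exact hz' hz
  rw [h1]
  simp only [chainSum, Finset.sum_mul]
  rw [Finset.sum_sigma']
  symm
  apply Finset.sum_bij (fun p _ => insert p.1 p.2)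
  · rintro ⟨z, C⟩ h
    simp only [Finset.mem_sigma, Finset.mem_filter, Finset.mem_univ, true_and,
      mem_openChains] at h
    obtain ⟨⟨hxz, hzy⟩, hC, hCz⟩ := h
    rw [Finset.mem_erase, mem_openChains]
    refine ⟨Finset.insert_ne_empty _ _, ?_, ?_⟩
    · rw [Finset.coe_insert]
      exact hC.insert fun w hw _ => Or.inr (hCz w hw).2.le
    · intro w hw
      rcases Finset.mem_insert.1 hw with rfl | hw
      · exact ⟨hxz, hzy⟩
      · exact ⟨(hCz w hw).1, (hCz w hw).2.trans hzy⟩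
  · rintro ⟨z, C⟩ h ⟨z', C'⟩ h' heq
    simp only [Finset.mem_sigma, Finset.mem_filter, Finset.mem_univ, true_and,
      mem_openChains] at h h' heq
    have hz : z ≤ z' := by
      rcases Finset.mem_insert.1 (heq ▸ Finset.mem_insert_self z C) with h1 | h1
      · exact h1.le
      · exact (h'.2.2 z h1).2.le
    have hz' : z' ≤ z := by
      rcases Finset.mem_insert.1 (heq.symm ▸ Finset.mem_insert_self z' C') with h1 | h1
      · exact h1.le
      · exact (h.2.2 z' h1).2.le
    obtain rfl := le_antisymm hz hz'
    have h1 : z ∉ C := fun hm => lt_irrefl _ (h.2.2 z hm).2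
    have h2 : z ∉ C' := fun hm => lt_irrefl _ (h'.2.2 z hm).2
    rw [← Finset.erase_insert h1, heq, Finset.erase_insert h2]
  · intro C hC
    rw [Finset.mem_erase, mem_openChains] at hC
    obtain ⟨hne, hC, hCxy⟩ := hC
    obtain ⟨z, hz, hmax⟩ := Finset.exists_max_image C ρ (Finset.nonempty_iff_ne_empty.2 hne)
    refine ⟨⟨z, C.erase z⟩, ?_, Finset.insert_erase hz⟩
    simp only [Finset.mem_sigma, Finset.mem_filter, Finset.mem_univ, true_and, mem_openChains]
    refine ⟨hCxy z hz, hC.mono (by simp), fun w hw => ?_⟩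
    rw [Finset.mem_erase] at hw
    refine ⟨(hCxy w hw.2).1, lt_of_le_of_ne ?_ hw.1⟩
    rcases hC hw.2 hz hw.1 with h | h
    · exact h
    · exact absurd (hmax w hw.2) (not_le.2 (hρ (lt_of_le_of_ne h (Ne.symm hw.1))))
  · rintro ⟨z, C⟩ h
    simp only [Finset.mem_sigma, Finset.mem_filter, Finset.mem_univ, true_and,
      mem_openChains] at h
    obtain ⟨⟨hxz, hzy⟩, hC, hCz⟩ := h
    have h1 := hρ hxz
    have h2 := hρ hzy
    dsimp only
    rw [rankKernel_of_lt ρ hzy, Finset.image_insert, weight_insert (by omega) (by omega)]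
    · congr 2
      omega
    · intro i hi
      obtain ⟨w, hw, rfl⟩ := Finset.mem_image.1 hi
      have h3 := hρ (hCz w hw).1
      have h4 := hρ (hCz w hw).2
      omega

open scoped Classical in
-- The signs in the flag h-vector are those of the expansion of a − b, so grouping chains by rank
-- set and exchanging the sums over S and T gives the claim.
theorem abIndex_eq_chainSum {ρ : P → ℕ} (hρ : StrictMono ρ) (h : posetRank (P := P) = ρ)
    {bot top : P} (hbot : IsBot bot) (htop : IsTop top) (h0 : ρ bot = 0) :
    abIndex P = chainSum ρ bot top := by
  have hfl : ∀ T, flagF P T = ((openChains bot top).filter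
      fun C => C.image (fun z => ρ z - ρ bot) = T).card := by
    intro T
    rw [flagF, ← Set.ncard_coe_finset]
    congr 1
    ext C
    have hb : ∀ x : P, ¬ IsBot x ↔ bot < x := fun x =>
      ⟨fun hx => lt_of_le_of_ne (hbot x) (by rintro rfl; exact hx hbot),
        fun hx hx' => absurd (hx' bot) hx.not_ge⟩
    have ht : ∀ x : P, ¬ IsTop x ↔ x < top := fun x =>
      ⟨fun hx => lt_of_le_of_ne (htop x) (by rintro rfl; exact hx htop),
        fun hx hx' => absurd (hx' top) hx.not_ge⟩
    simp only [Set.mem_ofPred_eq, Finset.coe_filter, mem_openChains, hb, ht, h, h0, Nat.sub_zero]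
    exact and_assoc.symm
  rw [abIndex, totalRank_eq hρ h htop, chainSum, h0, Nat.sub_zero]
  set n := ρ top - 1 with hn
  have hmem : ∀ C ∈ openChains bot top,
      C.image (fun z => ρ z - ρ bot) ∈ (Finset.Icc 1 n).powerset := by
    intro C hC
    rw [mem_openChains] at hC
    rw [Finset.mem_powerset]
    intro i hi
    obtain ⟨z, hz, rfl⟩ := Finset.mem_image.1 hi
    have h1 := hρ (hC.2 z hz).1
    have h2 := hρ (hC.2 z hz).2
    rw [Finset.mem_Icc]
    omega
  have hR : ∑ C ∈ openChains bot top, weight n (C.image fun z => ρ z - ρ bot) =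
      ∑ T ∈ (Finset.Icc 1 n).powerset, (flagF P T : ℤ) • weight n T := by
    rw [← Finset.sum_fiberwise_of_maps_to hmem]
    refine Finset.sum_congr rfl fun T _ => ?_
    rw [Finset.sum_congr rfl (g := fun _ => weight n T), Finset.sum_const, hfl]
    · simp
    · intro C hC
      rw [(Finset.mem_filter.1 hC).2]
  rw [h0] at hR
  rw [hR]
  simp only [weight_eq_sum, Finset.smul_sum]
  rw [Finset.sum_comm]
  refine Finset.sum_congr rfl fun S hS => ?_
  rw [flagH, Finset.sum_smul]
  rw [Finset.mem_powerset] at hS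
  have hsub : S.powerset ⊆ (Finset.Icc 1 n).powerset := Finset.powerset_mono.2 hS
  rw [← Finset.sum_subset hsub]
  · refine Finset.sum_congr rfl fun T hT => ?_
    rw [Finset.mem_powerset] at hT
    rw [if_pos (fun i _ hi => hT hi), smul_smul, mul_comm]
  · intro T hT hTS
    rw [Finset.mem_powerset] at hT hTS
    rw [if_neg, zero_smul, smul_zero]
    exact fun hh => hTS fun i hi => hh i (hT hi) hi

/-- A solution of the recursion for the `ab`-indices of the lower intervals computes the
`ab`-index. -/
theorem abIndex_eq_of_recursion {ρ : P → ℕ} (hρ : StrictMono ρ)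
    (hc : ∀ x, ρ x ≠ 0 → ∃ y < x, ρ y + 1 = ρ x) {bot top : P} (hbot : IsBot bot)
    (htop : IsTop top) (hne : bot ≠ top) (h0 : ρ bot = 0) (ψ : P → ABPoly) (hψ0 : ψ bot = 0)
    (hψ : ∀ y, y ≠ bot → ψ y = rankKernel ρ bot y + ∑ z, ψ z * b * rankKernel ρ z y) :
    abIndex P = ψ top := by
  classical
  rw [abIndex_eq_chainSum hρ (posetRank_eq ρ hρ hc) hbot htop h0]
  have key : ∀ n y, ρ y = n → y ≠ bot → chainSum ρ bot y = ψ y := by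
    intro n
    induction n using Nat.strong_induction_on with
    | _ n ih =>
      rintro y rfl hy
      rw [chainSum_eq ρ hρ (lt_of_le_of_ne (hbot y) hy.symm), hψ y hy]
      congr 1
      rw [Finset.sum_filter]
      refine Finset.sum_congr rfl fun z _ => ?_
      split_ifs with hz
      · by_cases hzy : z < y
        · rw [ih _ (hρ hzy) z rfl hz.ne']
        · simp [rankKernel_of_not_lt ρ hzy]
      · have : z = bot := by
          by_contra hzb
          exact hz (lt_of_le_of_ne (hbot z) (Ne.symm hzb))
        rw [this, hψ0, zero_mul, zero_mul]
  exact key _ top rfl hne.symm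

end Chains

/-! ### Index kernels, pyramids and shavings -/

section Ring

variable {R : Type*} [Ring R] {a b f p : R}

/-- With p = Ψ and f = φ this is the recursion for the upper layer of the pyramid. The two sides
differ by a combination of the defect of the recursion for p and the commutator of a − b with f. -/
theorem pyramid_identity (hp : p = f + p * b * f) (hf : (a - b) * f = f * (a - b)) :
    b * p + p * a + p * a * b * p = (a - b) * f + p * b * (1 + (a - b) * f) +
      (1 + (b * p + p * a + p * a * b * p)) * b * f := by
  have h1 : p * b * f - p + f = 0 := by nth_rw 2 [hp]; abel
  have h2 : (a - b) * f - f * (a - b) = 0 := sub_eq_zero.2 hf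
  have h : (a - b) * f + p * b * (1 + (a - b) * f) +
      (1 + (b * p + p * a + p * a * b * p)) * b * f - (b * p + p * a + p * a * b * p) =
      ((a - b) * f - f * (a - b)) + p * b * ((a - b) * f - f * (a - b)) +
        (p * b * f - p + f) * (a - b) + b * (p * b * f - p + f) +
        p * a * b * (p * b * f - p + f) := by
    noncomm_ring
  rw [h1, h2] at h
  simp only [mul_zero, zero_mul, add_zero] at h
  exact (sub_eq_zero.1 h).symm

/-- The analogue for the upper layer of the shaving; the term −bf makes up for the missing point (x,
x). -/
theorem shaving_identity (hp : p = f + p * b * f) (hf : (a - b) * f = f * (a - b)) :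
    p * a - a * p + p * a * b * p = -(b * f) + p * b * (1 + (a - b) * f) +
      (p * a - a * p + p * a * b * p) * b * f := by
  have h1 : p * b * f - p + f = 0 := by nth_rw 2 [hp]; abel
  have h2 : (a - b) * f - f * (a - b) = 0 := sub_eq_zero.2 hf
  have h : -(b * f) + p * b * (1 + (a - b) * f) +
      (p * a - a * p + p * a * b * p) * b * f - (p * a - a * p + p * a * b * p) =
      ((a - b) * f - f * (a - b)) + p * b * ((a - b) * f - f * (a - b)) +
        (p * b * f - p + f) * (a - b) - a * (p * b * f - p + f) +
        p * a * b * (p * b * f - p + f) := by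
    noncomm_ring
  rw [h1, h2] at h
  simp only [mul_zero, zero_mul, add_zero, sub_zero] at h
  exact (sub_eq_zero.1 h).symm

end Ring

theorem scalar_mul_apply {n : Type*} [Fintype n] [DecidableEq n] (x : ABPoly)
    (N : Matrix n n ABPoly) (i j : n) : (Matrix.scalar n x * N) i j = x * N i j := by
  simp [Matrix.scalar_apply]

theorem mul_scalar_apply {n : Type*} [Fintype n] [DecidableEq n] (x : ABPoly)
    (N : Matrix n n ABPoly) (i j : n) : (N * Matrix.scalar n x) i j = N i j * x := by
  simp [Matrix.scalar_apply]

theorem mul_scalar_mul_apply {n : Type*} [Fintype n] [DecidableEq n] (x : ABPoly)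
    (N N' : Matrix n n ABPoly) (i j : n) :
    (N * Matrix.scalar n x * N') i j = ∑ k, N i k * x * N' k j := by
  rw [Matrix.mul_apply]
  simp only [mul_scalar_apply]

section Kernels

variable {P : Type*} [PartialOrder P]

section
variable [Fintype P]

/-- The matrix of the `ab`-indices of the intervals of `P`, characterised by the recursion that
splits a chain at its largest element. -/
structure IsIndexKernel (ρ : P → ℕ) (Ψ : Matrix P P ABPoly) : Prop where
  -- The diagonal is 0, although a one-point poset has index 1. Formulas that allow equal endpoints
  -- therefore carry a separate term 1.
  zero : ∀ {x y : P}, ¬ x < y → Ψ x y = 0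
  eq : ∀ x y : P, Ψ x y = rankKernel ρ x y + ∑ z, Ψ x z * b * rankKernel ρ z y

open scoped Classical in
theorem isIndexKernel_chainSum {ρ : P → ℕ} (hρ : StrictMono ρ) :
    IsIndexKernel ρ (Matrix.of fun x y => if x < y then chainSum ρ x y else 0) := by
  refine ⟨fun h => by simp [h], fun x y => ?_⟩
  by_cases h : x < y
  · simp only [Matrix.of_apply, if_pos h]
    rw [chainSum_eq ρ hρ h, Finset.sum_filter]
    congr 1
    refine Finset.sum_congr rfl fun z _ => ?_
    split_ifs <;> simp
  · simp only [Matrix.of_apply, if_neg h]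
    rw [rankKernel_of_not_lt ρ h, Finset.sum_eq_zero, add_zero]
    intro z _
    by_cases hz : x < z
    · rw [rankKernel_of_not_lt ρ (fun hzy => h (hz.trans hzy)), mul_zero]
    · simp [hz]

variable [DecidableEq P] {ρ : P → ℕ} {Ψ : Matrix P P ABPoly}

theorem IsIndexKernel.matrix_eq (h : IsIndexKernel ρ Ψ) :
    Ψ = rankKernel ρ + Ψ * Matrix.scalar P b * rankKernel ρ := by
  ext x y
  rw [h.eq x y, Matrix.add_apply, Matrix.mul_apply]
  simp only [mul_scalar_apply]

end

theorem rankKernel_commute (ρ : P → ℕ) (x y : P) :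
    (a - b) * rankKernel ρ x y = rankKernel ρ x y * (a - b) := by
  by_cases h : x < y
  · rw [rankKernel_of_lt ρ h, ← pow_succ, ← pow_succ']
  · simp [rankKernel_of_not_lt ρ h]

theorem rankKernel_prod_zero_zero (ρ : P → ℕ) (x y : P) :
    rankKernel (fun p : P × Fin 2 => ρ p.1 + p.2) (x, 0) (y, 0) = rankKernel ρ x y := by
  by_cases h : x < y
  · rw [rankKernel_of_lt ρ h, rankKernel_of_lt _ (by simpa [Prod.lt_iff] using h)]
    simp
  · rw [rankKernel_of_not_lt ρ h, rankKernel_of_not_lt _ (by simpa [Prod.lt_iff] using h)]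

theorem rankKernel_prod_one_one (ρ : P → ℕ) (x y : P) :
    rankKernel (fun p : P × Fin 2 => ρ p.1 + p.2) (x, 1) (y, 1) = rankKernel ρ x y := by
  by_cases h : x < y
  · rw [rankKernel_of_lt ρ h, rankKernel_of_lt _ (by simpa [Prod.lt_iff] using h)]
    congr 1
    simp
  · rw [rankKernel_of_not_lt ρ h, rankKernel_of_not_lt _ (by simpa [Prod.lt_iff] using h)]

theorem rankKernel_prod_one_zero (ρ : P → ℕ) (x y : P) :
    rankKernel (fun p : P × Fin 2 => ρ p.1 + p.2) (x, 1) (y, 0) = 0 :=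
  rankKernel_of_not_lt _ (by simp [Prod.lt_iff])

/-- Between the layers x = y is already a strict relation, of rank difference one, whence the
identity matrix; for x < y the difference grows by one, whence the factor a − b. -/
theorem rankKernel_prod_zero_one [DecidableEq P] {ρ : P → ℕ} (hρ : StrictMono ρ) (x y : P) :
    rankKernel (fun p : P × Fin 2 => ρ p.1 + p.2) (x, 0) (y, 1) =
      (1 : Matrix P P ABPoly) x y + (a - b) * rankKernel ρ x y := by
  by_cases h : x ≤ y
  · rw [rankKernel_of_lt _ (by simp [Prod.lt_iff, h])]
    rcases h.eq_or_lt with rfl | h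
    · simp [rankKernel_of_not_lt ρ (lt_irrefl x)]
    · rw [rankKernel_of_lt ρ h, Matrix.one_apply_ne h.ne, zero_add, ← pow_succ']
      have := hρ h
      congr 1
      simp
      omega
  · rw [rankKernel_of_not_lt _ (by simpa [Prod.lt_iff, h] using fun h' : x < y => h h'.le),
      rankKernel_of_not_lt ρ (fun h' => h h'.le),
      Matrix.one_apply_ne (fun h' => h h'.le), mul_zero, zero_add]

variable [Fintype P] [DecidableEq P]

theorem IsIndexKernel.abIndex_pyr {ρ : P → ℕ} {Ψ : Matrix P P ABPoly} (h : IsIndexKernel ρ Ψ)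
    (hρ : StrictMono ρ) (hc : ∀ x, ρ x ≠ 0 → ∃ y < x, ρ y + 1 = ρ x) {bot top : P}
    (hbot : IsBot bot) (htop : IsTop top) (h0 : ρ bot = 0) :
    abIndex (Pyr P) = (if bot = top then 1 else 0) + b * Ψ bot top + Ψ bot top * a +
      ∑ z, Ψ bot z * a * b * Ψ z top := by
  set α := Matrix.scalar P a with hα
  set β := Matrix.scalar P b with hβ
  set Φ := rankKernel ρ with hΦ
  have hcomm : (α - β) * Φ = Φ * (α - β) := by
    rw [hα, hβ, ← map_sub]
    ext x y
    rw [scalar_mul_apply, mul_scalar_apply, rankKernel_commute]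
  -- The candidate for the upper layer of the pyramid; the lower layer is a copy of P and keeps Ψ.
  set X : Matrix P P ABPoly := 1 + (β * Ψ + Ψ * α + Ψ * α * β * Ψ) with hX
  have hXeq : X = 1 + (α - β) * Φ + Ψ * β * (1 + (α - β) * Φ) + X * β * Φ := by
    rw [hX, add_assoc 1, add_assoc 1, ← pyramid_identity h.matrix_eq hcomm]
  have hXapp : ∀ y, X bot y = (if bot = y then 1 else 0) + b * Ψ bot y + Ψ bot y * a +
      ∑ z, Ψ bot z * a * b * Ψ z y := by
    intro y
    rw [hX, Matrix.add_apply, Matrix.add_apply, Matrix.add_apply, Matrix.one_apply, hα, hβ,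
      scalar_mul_apply, mul_scalar_apply, Matrix.mul_apply]
    simp only [mul_scalar_apply, add_assoc]
  rw [← hXapp]
  have hstrict : StrictMono (fun p : P × Fin 2 => ρ p.1 + (p.2 : ℕ)) := by
    rintro ⟨x, i⟩ ⟨y, j⟩ hxy
    rw [Prod.lt_iff] at hxy
    rcases hxy with ⟨h1, h2⟩ | ⟨h1, h2⟩
    · exact add_lt_add_of_lt_of_le (hρ h1) h2
    · exact add_lt_add_of_le_of_lt (hρ.monotone h1) h2
  have := abIndex_eq_of_recursion (P := P × Fin 2) (ρ := fun p => ρ p.1 + (p.2 : ℕ)) hstrict ?_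
    (bot := (bot, 0)) (top := (top, 1)) ?_ ?_ ?_ ?_
    (fun p => if p.2 = 0 then Ψ bot p.1 else X bot p.1) ?_ ?_
  · simpa using this
  · rintro ⟨x, i⟩ hx
    fin_cases i
    · obtain ⟨y, hy, hyx⟩ := hc x (by simpa using hx)
      exact ⟨(y, 0), by simpa [Prod.lt_iff] using hy, by simpa using hyx⟩
    · exact ⟨(x, 0), by simp [Prod.lt_iff], by simp⟩
  · rintro ⟨y, j⟩
    exact ⟨hbot y, Fin.zero_le _⟩
  · rintro ⟨y, j⟩
    exact ⟨htop y, Fin.le_last _⟩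
  · simp
  · simpa using h0
  · simpa using h.zero (lt_irrefl bot)
  · rintro ⟨y, j⟩ -
    rw [Fintype.sum_prod_type]
    simp only [Fin.sum_univ_two]
    fin_cases j
    · simp only [Fin.zero_eta, Fin.isValue, if_true, rankKernel_prod_zero_zero,
        rankKernel_prod_one_zero, mul_zero, add_zero]
      exact h.eq bot y
    · simp only [Fin.mk_one, Fin.isValue, if_true, one_ne_zero, if_false,
        rankKernel_prod_zero_one hρ, rankKernel_prod_one_one]
      have := congrFun (congrFun hXeq bot) y
      rw [this, Finset.sum_add_distrib]
      simp only [Matrix.add_apply, mul_scalar_mul_apply, hα, hβ, ← map_sub, scalar_mul_apply, hΦ,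
        add_assoc]

end Kernels

/-! ### The ab-index of a shaving -/

section Shavings

variable {P : Type*} [PartialOrder P] {x : P}

/-- The lower layer consists of the bottom and the elements above x, the upper one of everything
except the bottom and x. The vanishing hypotheses extend both sums, so that only x is left out in
the upper one. -/
theorem Fintype.sum_shaving [Fintype P] [DecidableEq P] [Fintype (Shaving x)] {M : Type*}
    [AddCommMonoid M] {bot : P} (hbot : IsBot bot) (hx : bot ≠ x)
    (f : P → P → M) (hf : f bot bot = 0) (hlo : ∀ q, ¬ x < q → f q bot = 0)
    (hhi : f bot x = 0) :
    ∑ p : Shaving x, f p.1.1 p.1.2 = ∑ q, f q bot + ∑ q ∈ Finset.univ.erase x, f q x := by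
  classical
  have hb : ∀ q : P, IsBot q ↔ q = bot := fun q =>
    ⟨fun h => le_antisymm (h bot) (hbot q), fun h => h ▸ hbot⟩
  have h1 : ∑ q, f q bot = ∑ p : Shaving x with (p.1.2 : P) = bot, f p.1.1 p.1.2 := by
    rw [← Finset.sum_filter_of_ne (p := fun q => x < q ∨ q = bot)]
    · symm
      apply Finset.sum_bij (fun p _ => p.1.1)
      · rintro ⟨⟨p, q⟩, h⟩ hq
        simp only [Finset.mem_filter, Finset.mem_univ, true_and] at hq ⊢
        rcases h with h | h | h
        · exact absurd (hq.symm.trans h.2.2) hx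
        · exact Or.inl h.1
        · exact Or.inr ((hb p).1 h.1)
      · rintro ⟨⟨p, q⟩, h⟩ hq ⟨⟨p', q'⟩, h'⟩ hq' heq
        simp only [Finset.mem_filter, Finset.mem_univ, true_and] at hq hq' heq
        exact Subtype.ext (Prod.ext heq (Subtype.ext (hq.trans hq'.symm)))
      · intro q hq
        simp only [Finset.mem_filter, Finset.mem_univ, true_and] at hq
        refine ⟨⟨(q, ⟨bot, hbot x⟩), ?_⟩, by simp, rfl⟩
        rcases hq with hq | hq
        · exact Or.inr (Or.inl ⟨hq, hbot⟩)
        · exact Or.inr (Or.inr ⟨(hb q).2 hq, hbot⟩)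
      · rintro ⟨⟨p, q⟩, h⟩ hq
        simp only [Finset.mem_filter, Finset.mem_univ, true_and] at hq
        simp only [hq]
    · intro q _ hq
      by_contra hn
      push Not at hn
      exact hq (hlo q hn.1)
  have h2 : ∑ q ∈ Finset.univ.erase x, f q x =
      ∑ p : Shaving x with ¬ (p.1.2 : P) = bot, f p.1.1 p.1.2 := by
    rw [← Finset.sum_filter_of_ne (p := fun q => q ≠ bot)]
    · symm
      have key : ∀ p : Shaving x, ¬ (p.1.2 : P) = bot →
          (p.1.2 : P) = x ∧ p.1.1 ≠ bot ∧ p.1.1 ≠ x := by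
        rintro ⟨⟨p, q⟩, h⟩ hq
        rcases h with h | h | h
        · exact ⟨h.2.2, fun h' => h.1 ((hb p).2 h'), h.2.1⟩
        · exact absurd ((hb _).1 h.2) hq
        · exact absurd ((hb _).1 h.2) hq
      apply Finset.sum_bij (fun p _ => p.1.1)
      · intro p hp
        have := key p (Finset.mem_filter.1 hp).2
        simp [this]
      · intro p hp p' hp' heq
        have h1 := key p (Finset.mem_filter.1 hp).2
        have h2 := key p' (Finset.mem_filter.1 hp').2
        exact Subtype.ext (Prod.ext heq (Subtype.ext (h1.1.trans h2.1.symm)))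
      · intro q hq
        simp only [Finset.mem_filter, Finset.mem_erase, Finset.mem_univ, and_true] at hq
        exact ⟨⟨(q, ⟨x, le_rfl⟩), Or.inl ⟨fun h => hq.2 ((hb q).1 h), hq.1, rfl⟩⟩,
          by simp [hx.symm], rfl⟩
      · intro p hp
        rw [(key p (Finset.mem_filter.1 hp).2).1]
    · rintro q _ hq rfl
      exact hq hhi
  rw [h1, h2, Finset.sum_filter_add_sum_filter_not]

variable [Fintype P] [DecidableEq P]

theorem IsIndexKernel.abIndex_shaving {ρ : P → ℕ} {Ψ : Matrix P P ABPoly} (h : IsIndexKernel ρ Ψ)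
    (hρ : StrictMono ρ) (hc : ∀ y z, y < z → ∃ w, y ≤ w ∧ w < z ∧ ρ w + 1 = ρ z) {bot top : P}
    (hbot : IsBot bot) (htop : IsTop top) (h0 : ρ bot = 0) (hx : ρ x = 1) (hxtop : x ≠ top) :
    abIndex (Shaving x) = Ψ bot top + Ψ x top * a - a * Ψ x top +
      ∑ z, Ψ x z * a * b * Ψ z top := by
  classical
  have := Fintype.ofFinite (Shaving x)
  have hb : ∀ q : P, IsBot q ↔ q = bot := fun q =>
    ⟨fun h => le_antisymm (h bot) (hbot q), fun h => h ▸ hbot⟩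
  have hbx : bot < x := lt_of_le_of_ne (hbot x) (by rintro rfl; omega)
  set α := Matrix.scalar P a with hα
  set β := Matrix.scalar P b with hβ
  have hcomm : (α - β) * rankKernel ρ = rankKernel ρ * (α - β) := by
    rw [hα, hβ, ← map_sub]
    ext x y
    rw [scalar_mul_apply, mul_scalar_apply, rankKernel_commute]
  set D : Matrix P P ABPoly := Ψ * α - α * Ψ + Ψ * α * β * Ψ with hD
  have hDapp : ∀ y, D x y = Ψ x y * a - a * Ψ x y + ∑ z, Ψ x z * a * b * Ψ z y := by
    intro y
    rw [hD, Matrix.add_apply, Matrix.sub_apply, hα, hβ, scalar_mul_apply, mul_scalar_apply,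
      Matrix.mul_apply]
    simp only [mul_scalar_apply]
  have hDm := shaving_identity h.matrix_eq hcomm
  rw [← hD] at hDm
  have hDeq : ∀ y, D x y = -(b * rankKernel ρ x y) +
      ∑ z, Ψ x z * b * ((1 : Matrix P P ABPoly) z y + (a - b) * rankKernel ρ z y) +
      ∑ z, D x z * b * rankKernel ρ z y := by
    intro y
    conv_lhs => rw [hDm]
    simp only [Matrix.add_apply, Matrix.neg_apply, mul_scalar_mul_apply, hα, ← map_sub,
      scalar_mul_apply]
  have hgoal : Ψ bot top + Ψ x top * a - a * Ψ x top + ∑ z, Ψ x z * a * b * Ψ z top =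
      Ψ bot top + D x top := by
    rw [hDapp]; abel
  rw [hgoal]
  have hD0 : ∀ y, ¬ x < y → D x y = 0 := by
    intro y hy
    rw [hDapp, h.zero hy, Finset.sum_eq_zero]
    · simp
    · intro z _
      by_cases hz : x < z
      · rw [h.zero (fun h' => hy (hz.trans h')), mul_zero]
      · rw [h.zero hz]; simp
  have hΨx : Ψ bot x = 1 := by
    rw [h.eq, rankKernel_of_lt _ hbx, h0, hx, Finset.sum_eq_zero]
    · simp
    · intro z _
      by_cases hz : bot < z
      · rw [rankKernel_of_not_lt _ (fun h' => ?_), mul_zero]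
        have := hρ h'
        have := hρ hz
        omega
      · rw [h.zero hz]; simp
  -- The lower layer looks like [x, 1] with the bottom in place of x, so ranks drop by one there;
  -- truncated subtraction keeps the bottom at 0.
  set ρ' : Shaving x → ℕ := fun p => if (p.1.2 : P) = bot then ρ p.1.1 - 1 else ρ p.1.1 with hρ'
  have hcases : ∀ p : Shaving x, ((p.1.2 : P) = bot ∧ (x < p.1.1 ∨ p.1.1 = bot)) ∨
      ((p.1.2 : P) = x ∧ p.1.1 ≠ bot ∧ p.1.1 ≠ x) := by
    rintro ⟨⟨p, q⟩, h | h | h⟩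
    · exact Or.inr ⟨h.2.2, fun h' => h.1 ((hb p).2 h'), h.2.1⟩
    · exact Or.inl ⟨(hb _).1 h.2, Or.inl h.1⟩
    · exact Or.inl ⟨(hb _).1 h.2, Or.inr ((hb _).1 h.1)⟩
  have hlt : ∀ p q : Shaving x, p < q ↔ p.1.1 < q.1.1 ∧ (p.1.2 : P) ≤ q.1.2 ∨
      p.1.1 ≤ q.1.1 ∧ (p.1.2 : P) < q.1.2 := fun p q => Prod.lt_iff
  have hstrict : StrictMono ρ' := by
    intro p q hpq
    rw [hlt] at hpq
    simp only [hρ']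
    rcases hcases p with ⟨hp, hp'⟩ | ⟨hp, hp', hp''⟩ <;>
      rcases hcases q with ⟨hq, hq'⟩ | ⟨hq, hq', hq''⟩
    · have hpq' : p.1.1 < q.1.1 := by simpa [hp, hq] using hpq
      rw [if_pos hp, if_pos hq]
      have h1 := hρ hpq'
      rcases hq' with hq' | hq'
      · have := hρ hq'
        omega
      · rw [hq'] at h1
        omega
    · have hpq' : p.1.1 ≤ q.1.1 := by
        rcases hpq with h | h
        · exact h.1.le
        · exact h.1
      rw [if_pos hp, if_neg (by rw [hq]; exact hbx.ne')]
      have h1 := hρ.monotone hpq'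
      have h2 := hρ (lt_of_le_of_ne (hbot _) hq'.symm)
      omega
    · exfalso
      rw [hp, hq] at hpq
      rcases hpq with h | h
      · exact hbx.not_ge h.2
      · exact hbx.not_gt h.2
    · have hpq' : p.1.1 < q.1.1 := by simpa [hp, hq] using hpq
      rw [if_neg (by rw [hp]; exact hbx.ne'), if_neg (by rw [hq]; exact hbx.ne')]
      exact hρ hpq'
  have hcov : ∀ p, ρ' p ≠ 0 → ∃ q < p, ρ' q + 1 = ρ' p := by
    intro p hp0
    rcases hcases p with ⟨hp, hp'⟩ | ⟨hp, hp', hp''⟩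
    · simp only [hρ', hp, if_true] at hp0 ⊢
      rcases hp' with hp' | hp'
      · obtain ⟨w, hxw, hwp, hw⟩ := hc _ _ hp'
        rcases hxw.eq_or_lt with rfl | hxw
        · refine ⟨⟨(bot, ⟨bot, hbot x⟩), Or.inr (Or.inr ⟨hbot, hbot⟩)⟩, ?_, ?_⟩
          · rw [hlt]
            exact Or.inl ⟨hbx.trans hp', hbot _⟩
          · simp
            omega
        · refine ⟨⟨(w, ⟨bot, hbot x⟩), Or.inr (Or.inl ⟨hxw, hbot⟩)⟩, ?_, ?_⟩
          · rw [hlt]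
            exact Or.inl ⟨hwp, hbot _⟩
          · have := hρ hxw
            simp
            omega
      · rw [hp', h0] at hp0
        exact absurd rfl hp0
    · have hpb : ¬ (p.1.2 : P) = bot := by rw [hp]; exact hbx.ne'
      simp only [hρ', if_neg hpb] at hp0 ⊢
      by_cases hxp : x < p.1.1
      · refine ⟨⟨(p.1.1, ⟨bot, hbot x⟩), Or.inr (Or.inl ⟨hxp, hbot⟩)⟩, ?_, ?_⟩
        · rw [hlt]
          exact Or.inr ⟨le_rfl, by rw [hp]; exact hbx⟩
        · simp
          omega
      · obtain ⟨w, -, hwp, hw⟩ := hc _ _ (lt_of_le_of_ne (hbot _) hp'.symm)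
        by_cases hwb : w = bot
        · refine ⟨⟨(bot, ⟨bot, hbot x⟩), Or.inr (Or.inr ⟨hbot, hbot⟩)⟩, ?_, ?_⟩
          · rw [hlt]
            exact Or.inl ⟨hwb ▸ hwp, hbot _⟩
          · simp [← hw, hwb, h0]
        · have hwx : w ≠ x := by
            rintro rfl
            exact hxp hwp
          refine ⟨⟨(w, ⟨x, le_rfl⟩), Or.inl ⟨fun h => hwb ((hb w).1 h), hwx, rfl⟩⟩, ?_, ?_⟩
          · rw [hlt]
            exact Or.inl ⟨hwp, hp.ge⟩
          · simp [hbx.ne', hw]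
  have hlow : ∀ p : Shaving x, (p.1.2 : P) = bot → p.1.1 ≠ bot → x < p.1.1 := by
    intro p hp hp'
    rcases hcases p with ⟨-, h⟩ | ⟨h, -⟩
    · exact h.resolve_right hp'
    · exact absurd (hp.symm.trans h) hbx.ne
  have k1 : ∀ q p : Shaving x, (q.1.2 : P) = bot → q.1.1 ≠ bot → (p.1.2 : P) = bot →
      rankKernel ρ' q p = rankKernel ρ q.1.1 p.1.1 := by
    intro q p hq hq' hp
    have hiff : q < p ↔ q.1.1 < p.1.1 := by rw [hlt]; simp [hq, hp]
    by_cases hqp : q.1.1 < p.1.1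
    · rw [rankKernel_of_lt _ (hiff.2 hqp), rankKernel_of_lt _ hqp]
      simp only [hρ', hp, hq, if_true]
      have := hρ hqp
      have := hρ (hlow q hq hq')
      congr 1
      omega
    · rw [rankKernel_of_not_lt _ (fun h => hqp (hiff.1 h)), rankKernel_of_not_lt _ hqp]
  have k2 : ∀ q p : Shaving x, (q.1.2 : P) = x → (p.1.2 : P) = x →
      rankKernel ρ' q p = rankKernel ρ q.1.1 p.1.1 := by
    intro q p hq hp
    have hiff : q < p ↔ q.1.1 < p.1.1 := by rw [hlt]; simp [hq, hp]
    by_cases hqp : q.1.1 < p.1.1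
    · rw [rankKernel_of_lt _ (hiff.2 hqp), rankKernel_of_lt _ hqp]
      simp only [hρ', hp, hq, if_neg hbx.ne']
    · rw [rankKernel_of_not_lt _ (fun h => hqp (hiff.1 h)), rankKernel_of_not_lt _ hqp]
  have k3 : ∀ q p : Shaving x, (q.1.2 : P) = x → (p.1.2 : P) = bot → rankKernel ρ' q p = 0 := by
    intro q p hq hp
    refine rankKernel_of_not_lt _ fun h => ?_
    rw [hlt, hq, hp] at h
    rcases h with h | h
    · exact hbx.not_ge h.2
    · exact hbx.not_gt h.2
  have k4 : ∀ q p : Shaving x, (q.1.2 : P) = bot → q.1.1 ≠ bot → (p.1.2 : P) = x →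
      rankKernel ρ' q p =
        (1 : Matrix P P ABPoly) q.1.1 p.1.1 + (a - b) * rankKernel ρ q.1.1 p.1.1 := by
    intro q p hq hq' hp
    have hiff : q < p ↔ q.1.1 ≤ p.1.1 := by
      rw [hlt, hq, hp]
      exact ⟨fun h => h.elim (fun h => h.1.le) (fun h => h.1), fun h => Or.inr ⟨h, hbx⟩⟩
    have h1 := hρ (hlow q hq hq')
    by_cases hqp : q.1.1 ≤ p.1.1
    · rw [rankKernel_of_lt _ (hiff.2 hqp)]
      simp only [hρ', hp, hq, if_true, if_neg hbx.ne']
      rcases hqp.eq_or_lt with heq | hqp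
      · rw [← heq, rankKernel_of_not_lt _ (lt_irrefl _), Matrix.one_apply_eq, mul_zero, add_zero]
        have : ρ q.1.1 - (ρ q.1.1 - 1) - 1 = 0 := by omega
        rw [this, pow_zero]
      · rw [rankKernel_of_lt _ hqp, Matrix.one_apply_ne hqp.ne, zero_add, ← pow_succ']
        have := hρ hqp
        congr 1
        omega
    · rw [rankKernel_of_not_lt _ (fun h => hqp (hiff.1 h)),
        rankKernel_of_not_lt _ (fun h => hqp h.le), Matrix.one_apply_ne (fun h => hqp h.le),
        mul_zero, zero_add]
  -- Below a point of the lower layer lies a copy of an interval starting at x; on the upper layer D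
  -- is the correction to the index in P.
  set ψ : Shaving x → ABPoly := fun p =>
    if (p.1.2 : P) = bot then Ψ x p.1.1 else Ψ bot p.1.1 + D x p.1.1 with hψ
  have hbotS : ((¬ IsBot bot ∧ bot ≠ x ∧ ((⟨bot, hbot x⟩ : Set.Iic x) : P) = x) ∨
    (x < bot ∧ IsBot ((⟨bot, hbot x⟩ : Set.Iic x) : P)) ∨
    (IsBot bot ∧ IsBot ((⟨bot, hbot x⟩ : Set.Iic x) : P))) := Or.inr (Or.inr ⟨hbot, hbot⟩)
  have htopS : ((¬ IsBot top ∧ top ≠ x ∧ ((⟨x, le_rfl⟩ : Set.Iic x) : P) = x) ∨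
    (x < top ∧ IsBot ((⟨x, le_rfl⟩ : Set.Iic x) : P)) ∨
    (IsBot top ∧ IsBot ((⟨x, le_rfl⟩ : Set.Iic x) : P))) :=
    Or.inl ⟨fun h => absurd (h x) ((lt_of_le_of_ne (htop x) hxtop).not_ge), hxtop.symm, rfl⟩
  have := abIndex_eq_of_recursion (P := Shaving x) hstrict hcov
    (bot := ⟨(bot, ⟨bot, hbot x⟩), hbotS⟩) (top := ⟨(top, ⟨x, le_rfl⟩), htopS⟩)
    ?_ ?_ ?_ ?_ ψ ?_ ?_
  · rw [this, hψ]
    simp only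
    rw [if_neg hbx.ne']
  · intro p
    exact ⟨hbot _, hbot _⟩
  · intro p
    exact ⟨htop _, p.1.2.2⟩
  · intro heq
    have := congrArg (fun p : Shaving x => (p.1.2 : P)) heq
    exact hbx.ne this
  · simp [hρ', h0]
  · simp only [hψ, if_true]
    exact h.zero hbx.not_gt
  · intro p hpb
    have hx0 : Ψ x bot = 0 := h.zero hbx.not_gt
    have hpb' : (p.1.2 : P) = bot → p.1.1 ≠ bot := fun h1 h2 =>
      hpb (Subtype.ext (Prod.ext h2 (Subtype.ext h1)))
    have hbotp : (⟨(bot, ⟨bot, hbot x⟩), hbotS⟩ : Shaving x) < p :=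
      lt_of_le_of_ne ⟨hbot _, hbot _⟩ hpb.symm
    rcases hcases p with ⟨hp, hp'⟩ | ⟨hp, hp', hp''⟩
    · have hxp := hlow p hp (hpb' hp)
      obtain ⟨f, hf⟩ : ∃ f : P → P → ABPoly, f = fun q₁ q₂ =>
        if q₂ = bot then Ψ x q₁ * b * rankKernel ρ q₁ p.1.1 else 0 := ⟨_, rfl⟩
      have h1 : ∀ q : Shaving x, ψ q * b * rankKernel ρ' q p = f q.1.1 q.1.2 := by
        intro q
        rw [hf]
        by_cases hq : (q.1.2 : P) = bot
        · by_cases hqb : q.1.1 = bot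
          · simp [hψ, hq, hqb, hx0]
          · rw [k1 q p hq hqb hp]
            simp [hψ, hq]
        · rw [k3 q p (by rcases hcases q with h | h; exacts [absurd h.1 hq, h.1]) hp]
          simp [hq]
      rw [Finset.sum_congr rfl fun q _ => h1 q, Fintype.sum_shaving hbot hbx.ne f]
      · simp only [hf, if_true, if_neg hbx.ne', Finset.sum_const_zero, add_zero]
        rw [rankKernel_of_lt _ hbotp]
        simp only [hψ, hp, if_true, hρ', h0]
        rw [h.eq, rankKernel_of_lt ρ hxp, hx]
        congr 2
      · simp [hf, hx0]
      · intro q hq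
        simp [hf, h.zero hq]
      · simp [hf, hbx.ne']
    · have hpb2 : (p.1.2 : P) ≠ bot := by rw [hp]; exact hbx.ne'
      obtain ⟨f, hf⟩ : ∃ f : P → P → ABPoly, f = fun q₁ q₂ =>
        if q₂ = bot then
          Ψ x q₁ * b * ((1 : Matrix P P ABPoly) q₁ p.1.1 + (a - b) * rankKernel ρ q₁ p.1.1)
        else (Ψ bot q₁ + D x q₁) * b * rankKernel ρ q₁ p.1.1 := ⟨_, rfl⟩
      have h1 : ∀ q : Shaving x, ψ q * b * rankKernel ρ' q p = f q.1.1 q.1.2 := by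
        intro q
        rw [hf]
        by_cases hq : (q.1.2 : P) = bot
        · by_cases hqb : q.1.1 = bot
          · simp [hψ, hq, hqb, hx0]
          · rw [k4 q p hq hqb hp]
            simp [hψ, hq]
        · rw [k2 q p (by rcases hcases q with h | h; exacts [absurd h.1 hq, h.1]) hp]
          simp [hψ, hq]
      rw [Finset.sum_congr rfl fun q _ => h1 q, Fintype.sum_shaving hbot hbx.ne f]
      · simp only [hf, if_true, if_neg hbx.ne']
        -- The omitted summand at x is b times the kernel, because Ψ is 1 and D is 0 there. It is
        -- exactly the negative term in the recursion for D.
        have h2 := Finset.add_sum_erase Finset.univ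
          (fun q => (Ψ bot q + D x q) * b * rankKernel ρ q p.1.1) (Finset.mem_univ x)
        simp only [hΨx, hD0 x (lt_irrefl x), add_zero, one_mul] at h2
        rw [eq_sub_of_add_eq' h2, rankKernel_of_lt _ hbotp]
        simp only [hψ, if_neg hpb2, if_true, hρ', h0]
        conv_lhs => rw [h.eq, rankKernel_of_lt ρ (lt_of_le_of_ne (hbot _) hp'.symm), h0, hDeq]
        simp only [add_mul, Finset.sum_add_distrib, Nat.zero_sub]
        abel
      · simp [hf, hx0]
      · intro q hq
        simp [hf, h.zero hq]
      · simp [hf, hbx.ne', h.zero (lt_irrefl bot), hD0 bot hbx.not_gt]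

end Shavings

namespace CoxeterSystem

variable {B W : Type*} [Group W] {M : CoxeterMatrix B} (cs : CoxeterSystem M W)

/-! ### The index kernel of Bruhat order -/

open scoped Classical in
/-- The `ab`-index of `[u, w]` for `u < w`, and `0` otherwise. -/
noncomputable def bruhatKernel (u w : W) : ABPoly :=
  if cs.BruhatLT u w then cs.bruhatIndex u w else 0

open scoped Classical in
/-- The contribution of the empty chain to the `ab`-index of `[u, w]`. -/
noncomputable def bruhatRankKernel (u w : W) : ABPoly :=
  if cs.BruhatLT u w then (a - b) ^ (cs.length w - cs.length u - 1) else 0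

variable {cs}

theorem BruhatLT.length_lt {u w : W} (h : cs.BruhatLT u w) : cs.length u < cs.length w :=
  BruhatLE.length_lt h.1 h.2

theorem BruhatLT.trans_le {u v w : W} (h : cs.BruhatLT u v) (h' : cs.BruhatLE v w) :
    cs.BruhatLT u w := by
  refine ⟨h.1.trans h', ?_⟩
  rintro rfl
  exact h.2 (h.1.antisymm h')

theorem BruhatLE.trans_lt {u v w : W} (h : cs.BruhatLE u v) (h' : cs.BruhatLT v w) :
    cs.BruhatLT u w := by
  refine ⟨h.trans h'.1, ?_⟩
  rintro rfl
  exact h'.2 (h'.1.antisymm h)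

theorem bruhatKernel_of_lt {u w : W} (h : cs.BruhatLT u w) :
    cs.bruhatKernel u w = cs.bruhatIndex u w := by simp [bruhatKernel, h]

theorem bruhatKernel_of_not_lt {u w : W} (h : ¬ cs.BruhatLT u w) :
    cs.bruhatKernel u w = 0 := by simp [bruhatKernel, h]

theorem bruhatRankKernel_of_lt {u w : W} (h : cs.BruhatLT u w) :
    cs.bruhatRankKernel u w = (a - b) ^ (cs.length w - cs.length u - 1) := by
  simp [bruhatRankKernel, h]

theorem bruhatRankKernel_of_not_lt {u w : W} (h : ¬ cs.BruhatLT u w) :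
    cs.bruhatRankKernel u w = 0 := by simp [bruhatRankKernel, h]

theorem bruhatIcc_lt_iff {x y : W} {u w : cs.bruhatIcc x y} : u < w ↔ cs.BruhatLT u.1 w.1 := by
  rw [lt_iff_le_and_ne, BruhatLT, Ne, Subtype.ext_iff]
  rfl

/-- The rank function of a Bruhat interval. -/
noncomputable def bruhatRank (x : W) {y : W} (z : cs.bruhatIcc x y) : ℕ :=
  cs.length z.1 - cs.length x

theorem strictMono_bruhatRank (x y : W) :
    StrictMono (bruhatRank (cs := cs) x (y := y)) := by
  intro u w h
  rw [bruhatIcc_lt_iff] at h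
  have h1 := h.length_lt
  have h2 := u.2.1.length_le
  simp only [bruhatRank]
  omega

theorem bruhatRank_exists_coatom {x y : W} (u w : cs.bruhatIcc x y) (h : u < w) :
    ∃ z, u ≤ z ∧ z < w ∧ bruhatRank (cs := cs) x z + 1 = bruhatRank (cs := cs) x w := by
  rw [bruhatIcc_lt_iff] at h
  obtain ⟨z, hz1, hz2, hz3⟩ := h.1.exists_coatom h.2
  refine ⟨⟨z, u.2.1.trans hz1, hz2.trans w.2.2⟩, hz1, ?_, ?_⟩
  · rw [bruhatIcc_lt_iff]
    refine ⟨hz2, ?_⟩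
    rintro rfl
    simp at hz3
  · have h2 := u.2.1.length_le
    have h3 := hz1.length_le
    simp only [bruhatRank]
    omega

theorem bruhatRank_exists_pred {x y : W} (w : cs.bruhatIcc x y)
    (h : bruhatRank (cs := cs) x w ≠ 0) :
    ∃ z < w, bruhatRank (cs := cs) x z + 1 = bruhatRank (cs := cs) x w := by
  obtain ⟨z, -, hz⟩ := bruhatRank_exists_coatom (cs := cs)
    ⟨x, BruhatLE.refl cs x, w.2.1.trans w.2.2⟩ w (by
      rw [bruhatIcc_lt_iff]
      refine ⟨w.2.1, ?_⟩
      intro h'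
      simp only at h'
      simp [bruhatRank, ← h'] at h)
  exact ⟨z, hz⟩

theorem rankKernel_bruhatRank {x y : W} (u w : cs.bruhatIcc x y) :
    rankKernel (bruhatRank (cs := cs) x) u w = cs.bruhatRankKernel u.1 w.1 := by
  by_cases h : u < w
  · rw [rankKernel_of_lt _ h]
    rw [bruhatIcc_lt_iff] at h
    rw [bruhatRankKernel_of_lt h]
    have h1 := h.length_lt
    have h2 := u.2.1.length_le
    simp only [bruhatRank]
    congr 1
    omega
  · rw [rankKernel_of_not_lt _ h]
    rw [bruhatIcc_lt_iff] at h
    rw [bruhatRankKernel_of_not_lt h]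

noncomputable instance (x y : W) : Fintype (cs.bruhatIcc x y) :=
  (cs.finite_bruhatIcc x y).fintype

/-- The rank functions of [u, w] and of the ambient interval differ by a constant, which cancels in
the kernel; both sides thus obey one recursion. -/
theorem bruhatIndex_eq_chainSum {x y : W} (u w : cs.bruhatIcc x y) (h : u < w) :
    cs.bruhatIndex u.1 w.1 = chainSum (bruhatRank (cs := cs) x) u w := by
  classical
  have huw := bruhatIcc_lt_iff.1 h
  have hK := isIndexKernel_chainSum (strictMono_bruhatRank (cs := cs) x y)
  set Ψ : Matrix (cs.bruhatIcc x y) (cs.bruhatIcc x y) ABPoly :=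
    Matrix.of fun u w => if u < w then chainSum (bruhatRank (cs := cs) x) u w else 0 with hΨ
  set e : cs.bruhatIcc u.1 w.1 → cs.bruhatIcc x y :=
    fun z => ⟨z.1, u.2.1.trans z.2.1, z.2.2.trans w.2.2⟩ with he
  have hinj : Function.Injective e := fun z z' h =>
    Subtype.ext (congrArg (fun v : cs.bruhatIcc x y => v.1) h)
  have := abIndex_eq_of_recursion (strictMono_bruhatRank (cs := cs) u.1 w.1)
    bruhatRank_exists_pred (bot := ⟨u.1, BruhatLE.refl cs _, huw.1⟩)
    (top := ⟨w.1, huw.1, BruhatLE.refl cs _⟩) (fun z => z.2.1) (fun z => z.2.2)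
    (fun h' => huw.2 (congrArg (fun v : cs.bruhatIcc u.1 w.1 => v.1) h')) (by simp [bruhatRank]) (fun z => Ψ u (e z)) ?_ ?_
  · rw [bruhatIndex, this, hΨ]
    simp [he, h]
  · exact hK.zero (lt_irrefl u)
  · intro z _
    rw [hK.eq, rankKernel_bruhatRank, rankKernel_bruhatRank]
    congr 1
    symm
    apply Fintype.sum_of_injective e hinj
    · intro v hv
      by_cases h1 : u < v
      · rw [rankKernel_of_not_lt, mul_zero]
        intro h2
        exact hv ⟨⟨v.1, h1.le, le_trans (α := cs.bruhatIcc x y) h2.le z.2.2⟩, rfl⟩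
      · rw [hK.zero h1, zero_mul, zero_mul]
    · intro v
      rw [rankKernel_bruhatRank, rankKernel_bruhatRank]

theorem isIndexKernel_bruhatKernel (x y : W) :
    IsIndexKernel (bruhatRank (cs := cs) x)
      (Matrix.of fun u w : cs.bruhatIcc x y => cs.bruhatKernel u.1 w.1) := by
  classical
  convert isIndexKernel_chainSum (strictMono_bruhatRank (cs := cs) x y) using 1
  ext u w
  simp only [Matrix.of_apply]
  by_cases h : u < w
  · rw [if_pos h, bruhatKernel_of_lt (bruhatIcc_lt_iff.1 h), bruhatIndex_eq_chainSum u w h]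
  · rw [if_neg h, bruhatKernel_of_not_lt (fun h' => h (bruhatIcc_lt_iff.2 h'))]

/-- As h vanishes outside the open interval, the index set may be changed freely as long as it
contains that interval. -/
theorem sum_bruhatIcc {A : Type*} [AddCommMonoid A] (u w : W) (h : W → A) (F : Finset W)
    (hF : ∀ v, cs.BruhatLT u v → cs.BruhatLT v w → v ∈ F)
    (h0 : ∀ v, ¬ (cs.BruhatLT u v ∧ cs.BruhatLT v w) → h v = 0) :
    ∑ v : cs.bruhatIcc u w, h v.1 = ∑ v ∈ F, h v := by
  classical
  have h1 : ∑ v : cs.bruhatIcc u w, h v.1 = ∑ v ∈ (cs.finite_bruhatIcc u w).toFinset, h v :=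
    (Finset.sum_subtype _ (by simp) h).symm
  have h2 : ∀ G : Finset W, cs.bruhatIooFinset u w ⊆ G →
      ∑ v ∈ cs.bruhatIooFinset u w, h v = ∑ v ∈ G, h v := by
    intro G hG
    refine Finset.sum_subset hG fun v _ hv => h0 v ?_
    simpa [bruhatIooFinset, bruhatIoo] using hv
  rw [h1, ← h2 F, ← h2 (cs.finite_bruhatIcc u w).toFinset]
  · intro v hv
    have := (Set.Finite.mem_toFinset _).1 hv
    exact (Set.Finite.mem_toFinset _).2 ⟨this.1.1, this.2.1⟩
  · intro v hv
    have := (Set.Finite.mem_toFinset _).1 hv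
    exact hF v this.1 this.2

theorem bruhatKernel_eq (u w : W) (F : Finset W)
    (hF : ∀ v, cs.BruhatLT u v → cs.BruhatLT v w → v ∈ F) :
    cs.bruhatKernel u w = cs.bruhatRankKernel u w +
      ∑ v ∈ F, cs.bruhatKernel u v * b * cs.bruhatRankKernel v w := by
  have h0 : ∀ v, ¬ (cs.BruhatLT u v ∧ cs.BruhatLT v w) →
      cs.bruhatKernel u v * b * cs.bruhatRankKernel v w = 0 := by
    intro v hv
    rcases not_and_or.1 hv with h | h
    · rw [bruhatKernel_of_not_lt h, zero_mul, zero_mul]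
    · rw [bruhatRankKernel_of_not_lt h, mul_zero]
  by_cases h : cs.BruhatLT u w
  · have := (isIndexKernel_bruhatKernel (cs := cs) u w).eq
      ⟨u, BruhatLE.refl cs u, h.1⟩ ⟨w, h.1, BruhatLE.refl cs w⟩
    simp only [Matrix.of_apply, rankKernel_bruhatRank] at this
    rw [this, sum_bruhatIcc u w (fun v => cs.bruhatKernel u v * b * cs.bruhatRankKernel v w) F
      hF h0]
  · rw [bruhatKernel_of_not_lt h, bruhatRankKernel_of_not_lt h, Finset.sum_eq_zero, add_zero]
    exact fun v _ => h0 v fun h' => h (h'.1.trans_le h'.2.1)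

end CoxeterSystem

/-! ### The recursion along a simple reflection -/

section Ring

variable {R : Type*} [Ring R] {a b f g p q r t : R}

/-- Here z and z' are the proposed formulas for q and t minus q and t. The companions y and y' close
the system: (z, y) and (z', y') satisfy the homogeneous forms of the recursions for (p, q) and (r,
t). -/
theorem block_identities (hp : p = f + p * b * f + q * b * g)
    (hq : q = 1 + (a - b) * f + p * b * (1 + (a - b) * f) + q * b * f)
    (hr : r = g + r * b * f + t * b * g)
    (ht : t = f + r * b * (1 + (a - b) * f) + t * b * f)
    (hf : (a - b) * f = f * (a - b)) (hg : (a - b) * g = g * (a - b))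
    {z y z' y' : R} (hz : z = 1 + b * p + p * a + p * a * b * p - q * b * a * r - q)
    (hy : y = b * q - q * b + p * a * b * q - q * b * a * t)
    (hz' : z' = p + r * a - a * r + r * a * b * p - t * b * a * r - t)
    (hy' : y' = q - 1 - a * t + r * a * b * q - t * b - t * b * a * t) :
    z = z * b * f + y * b * g ∧ y = y * b * f + z * b * (1 + (a - b) * f) ∧
      z' = z' * b * f + y' * b * g ∧ y' = y' * b * f + z' * b * (1 + (a - b) * f) := by
  have p0 : f + p * b * f + q * b * g - p = 0 := sub_eq_zero.2 hp.symm
  have q0 : 1 + (a - b) * f + p * b * (1 + (a - b) * f) + q * b * f - q = 0 :=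
    sub_eq_zero.2 hq.symm
  have r0 : g + r * b * f + t * b * g - r = 0 := sub_eq_zero.2 hr.symm
  have t0 : f + r * b * (1 + (a - b) * f) + t * b * f - t = 0 := sub_eq_zero.2 ht.symm
  have f0 : (a - b) * f - f * (a - b) = 0 := sub_eq_zero.2 hf
  have g0 : (a - b) * g - g * (a - b) = 0 := sub_eq_zero.2 hg
  clear hp hq hr ht hf hg
  refine ⟨?_, ?_, ?_, ?_⟩
  · have h : z * b * f + y * b * g - z =
        b * (f + p * b * f + q * b * g - p) + p * a * b * (f + p * b * f + q * b * g - p) -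
        q * b * a * (g + r * b * f + t * b * g - r) -
        (1 + (a - b) * f + p * b * (1 + (a - b) * f) + q * b * f - q) +
        (f + p * b * f + q * b * g - p) * (a - b) +
        (1 + p * b) * ((a - b) * f - f * (a - b)) + q * b * ((a - b) * g - g * (a - b)) := by
      rw [hz, hy]
      noncomm_ring
    rw [p0, q0, r0, f0, g0] at h
    simp only [mul_zero, zero_mul, add_zero, sub_zero] at h
    exact (sub_eq_zero.1 h).symm
  · have h : y * b * f + z * b * (1 + (a - b) * f) - y =
        b * (1 + (a - b) * f + p * b * (1 + (a - b) * f) + q * b * f - q) +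
        p * a * b * (1 + (a - b) * f + p * b * (1 + (a - b) * f) + q * b * f - q) -
        q * b * a * (f + r * b * (1 + (a - b) * f) + t * b * f - t) := by
      rw [hz, hy]
      noncomm_ring
    rw [q0, t0] at h
    simp only [mul_zero, add_zero, sub_zero] at h
    exact (sub_eq_zero.1 h).symm
  · have h : z' * b * f + y' * b * g - z' =
        -(a * (g + r * b * f + t * b * g - r)) + r * a * b * (f + p * b * f + q * b * g - p) -
        t * b * a * (g + r * b * f + t * b * g - r) + (f + p * b * f + q * b * g - p) +
        (g + r * b * f + t * b * g - r) * (a - b) + r * b * ((a - b) * f - f * (a - b)) +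
        (1 + t * b) * ((a - b) * g - g * (a - b)) -
        (f + r * b * (1 + (a - b) * f) + t * b * f - t) := by
      rw [hz', hy']
      noncomm_ring
    rw [p0, r0, t0, f0, g0] at h
    simp only [mul_zero, zero_mul, add_zero, sub_zero, neg_zero] at h
    exact (sub_eq_zero.1 h).symm
  · have h : y' * b * f + z' * b * (1 + (a - b) * f) - y' =
        (1 + (a - b) * f + p * b * (1 + (a - b) * f) + q * b * f - q) -
        a * (f + r * b * (1 + (a - b) * f) + t * b * f - t) +
        r * a * b * (1 + (a - b) * f + p * b * (1 + (a - b) * f) + q * b * f - q) -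
        t * b * a * (f + r * b * (1 + (a - b) * f) + t * b * f - t) := by
      rw [hz', hy']
      noncomm_ring
    rw [q0, t0] at h
    simp only [mul_zero, add_zero, sub_zero] at h
    exact (sub_eq_zero.1 h).symm

end Ring

/-- A homogeneous system of recursions with strictly triangular coefficients has only the zero
solution. -/
theorem eq_zero_of_block_recursion {n : Type*} [Fintype n] [DecidableEq n] (ℓ : n → ℕ)
    {z y f g : Matrix n n ABPoly} (e b : ABPoly)
    (hf : ∀ i j, ¬ ℓ i < ℓ j → f i j = 0) (hg : ∀ i j, ¬ ℓ i < ℓ j → g i j = 0)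
    (hz : z = z * Matrix.scalar n b * f + y * Matrix.scalar n b * g)
    (hy : y = y * Matrix.scalar n b * f +
      z * Matrix.scalar n b * (1 + Matrix.scalar n e * f)) : z = 0 := by
  have key : ∀ k, ∀ i j, ℓ j = k → z i j = 0 ∧ y i j = 0 := by
    intro k
    induction k using Nat.strong_induction_on with
    | _ k ih =>
      rintro i j rfl
      -- The entry of z comes first, since the entry of y in the same column involves it through the
      -- summand 1.
      have hzij : z i j = 0 := by
        rw [hz, Matrix.add_apply, mul_scalar_mul_apply, mul_scalar_mul_apply,
          Finset.sum_eq_zero, Finset.sum_eq_zero, add_zero]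
        · intro m _
          by_cases hm : ℓ m < ℓ j
          · rw [(ih _ hm i m rfl).2, zero_mul, zero_mul]
          · rw [hg _ _ hm, mul_zero]
        · intro m _
          by_cases hm : ℓ m < ℓ j
          · rw [(ih _ hm i m rfl).1, zero_mul, zero_mul]
          · rw [hf _ _ hm, mul_zero]
      refine ⟨hzij, ?_⟩
      rw [hy, Matrix.add_apply, mul_scalar_mul_apply, mul_scalar_mul_apply,
        Finset.sum_eq_zero, Finset.sum_eq_zero, add_zero]
      · intro m _
        rw [Matrix.add_apply, scalar_mul_apply]
        by_cases hm : ℓ m < ℓ j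
        · rw [(ih _ hm i m rfl).1, zero_mul, zero_mul]
        · rw [hf _ _ hm]
          by_cases hmj : m = j
          · rw [hmj, hzij, zero_mul, zero_mul]
          · rw [Matrix.one_apply_ne hmj, mul_zero, add_zero, mul_zero]
      · intro m _
        by_cases hm : ℓ m < ℓ j
        · rw [(ih _ hm i m rfl).2, zero_mul, zero_mul]
        · rw [hf _ _ hm, mul_zero]
  ext i j
  exact (key _ i j rfl).1

namespace CoxeterSystem

variable {B W : Type*} [Group W] {M : CoxeterMatrix B} (cs : CoxeterSystem M W)

/-- The elements below `w` that are shorter than their product with the simple reflection `i`. -/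
def ascentsBelow (i : B) (w : W) : Set W :=
  {v | cs.length v < cs.length (v * cs.simple i) ∧ cs.BruhatLE v w}

noncomputable instance (i : B) (w : W) : Fintype (cs.ascentsBelow i w) :=
  ((cs.finite_bruhatIcc 1 w).subset fun v hv => ⟨fun ω _ _ => ⟨[], by simp, by simp [IsReduced],
    by simp⟩, hv.2⟩).fintype

variable {cs} {i : B}

theorem bruhatLT_mul_simple_iff_le {u w : W} (hu : cs.length u < cs.length (u * cs.simple i))
    (hw : cs.length w < cs.length (w * cs.simple i)) :
    cs.BruhatLT u (w * cs.simple i) ↔ cs.BruhatLE u w := by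
  refine ⟨fun h => h.1.of_le_mul_simple hw hu, fun h => ⟨h.trans (bruhatLE_mul_simple hw), ?_⟩⟩
  rintro rfl
  simp at hu
  omega

theorem mul_simple_bruhatLT_mul_simple_iff {u w : W}
    (hu : cs.length u < cs.length (u * cs.simple i))
    (hw : cs.length w < cs.length (w * cs.simple i)) :
    cs.BruhatLT (u * cs.simple i) (w * cs.simple i) ↔ cs.BruhatLT u w := by
  refine ⟨fun h => ⟨?_, fun he => h.2 (by rw [he])⟩,
    fun h => ⟨h.1.mul_simple_le_mul_simple hw, fun he => h.2 (mul_right_cancel he)⟩⟩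
  exact ((bruhatLE_mul_simple hu).trans h.1).of_le_mul_simple hw hu

theorem length_mul_simple_of_lt {w : W} (hw : cs.length w < cs.length (w * cs.simple i)) :
    cs.length (w * cs.simple i) = cs.length w + 1 := by
  rcases cs.length_mul_simple w i with h | h <;> omega

theorem bruhatRankKernel_mul_simple_mul_simple {u w : W}
    (hu : cs.length u < cs.length (u * cs.simple i))
    (hw : cs.length w < cs.length (w * cs.simple i)) :
    cs.bruhatRankKernel (u * cs.simple i) (w * cs.simple i) = cs.bruhatRankKernel u w := by
  by_cases h : cs.BruhatLT u w
  · rw [bruhatRankKernel_of_lt h,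
      bruhatRankKernel_of_lt ((mul_simple_bruhatLT_mul_simple_iff hu hw).2 h),
      length_mul_simple_of_lt hu, length_mul_simple_of_lt hw]
    congr 1
    omega
  · rw [bruhatRankKernel_of_not_lt h, bruhatRankKernel_of_not_lt
      (fun h' => h ((mul_simple_bruhatLT_mul_simple_iff hu hw).1 h'))]

open scoped Classical in
-- By lifting, u < ws amounts to u ≤ w. Equality gives the identity block, and the extra unit of
-- length gives the factor a − b, just as between the layers of a pyramid.
theorem bruhatRankKernel_mul_simple {u w : W}
    (hu : cs.length u < cs.length (u * cs.simple i))
    (hw : cs.length w < cs.length (w * cs.simple i)) :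
    cs.bruhatRankKernel u (w * cs.simple i) =
      (if u = w then 1 else 0) + (a - b) * cs.bruhatRankKernel u w := by
  by_cases h : cs.BruhatLE u w
  · rw [bruhatRankKernel_of_lt ((bruhatLT_mul_simple_iff_le hu hw).2 h),
      length_mul_simple_of_lt hw]
    by_cases he : u = w
    · subst he
      rw [if_pos rfl, bruhatRankKernel_of_not_lt (fun h' => h'.2 rfl)]
      simp
    · rw [if_neg he, bruhatRankKernel_of_lt ⟨h, he⟩, zero_add, ← pow_succ']
      have := h.length_lt he
      congr 1
      omega
  · rw [bruhatRankKernel_of_not_lt (fun h' => h ((bruhatLT_mul_simple_iff_le hu hw).1 h')),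
      bruhatRankKernel_of_not_lt (fun h' => h h'.1), if_neg, mul_zero, add_zero]
    rintro rfl
    exact h (BruhatLE.refl cs _)

/-- Ascents and their products with s are disjoint families, so two copies of J embed in the group,
and their image contains F. Points of the image outside F do no harm as h vanishes there. -/
theorem sum_ascentsBelow {A : Type*} [AddCommMonoid A] (w : W) (F : Finset W) (h : W → A)
    (hF : ∀ v ∈ F, (cs.length v < cs.length (v * cs.simple i) → cs.BruhatLE v w) ∧
      (cs.length (v * cs.simple i) < cs.length v → cs.BruhatLE (v * cs.simple i) w))
    (h0 : ∀ v ∉ F, h v = 0) :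
    ∑ v : cs.ascentsBelow i w, h v.1 + ∑ v : cs.ascentsBelow i w, h (v.1 * cs.simple i) =
      ∑ v ∈ F, h v := by
  classical
  let e : cs.ascentsBelow i w ⊕ cs.ascentsBelow i w → W :=
    Sum.elim (fun v => v.1) (fun v => v.1 * cs.simple i)
  have hinj : Function.Injective e := by
    rintro (⟨v, hv⟩ | ⟨v, hv⟩) (⟨v', hv'⟩ | ⟨v', hv'⟩) h
    · simp only [e, Sum.elim_inl] at h
      subst h; rfl
    · simp only [e, Sum.elim_inl, Sum.elim_inr] at h
      subst h
      have := hv.1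
      have := hv'.1
      rw [simple_mul_simple_cancel_right] at *
      omega
    · simp only [e, Sum.elim_inl, Sum.elim_inr] at h
      subst h
      have := hv.1
      have := hv'.1
      rw [simple_mul_simple_cancel_right] at *
      omega
    · simp only [e, Sum.elim_inr] at h
      have := mul_right_cancel h
      subst this; rfl
  have h1 : ∑ v : cs.ascentsBelow i w, h v.1 + ∑ v : cs.ascentsBelow i w, h (v.1 * cs.simple i) =
      ∑ x : cs.ascentsBelow i w ⊕ cs.ascentsBelow i w, h (e x) := by
    rw [Fintype.sum_sum_type]; rfl
  rw [h1, ← Finset.sum_image (s := Finset.univ) (g := e) (f := h) (fun _ _ _ _ h => hinj h)]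
  symm
  apply Finset.sum_subset
  · intro v hv
    rw [Finset.mem_image]
    rcases length_lt_mul_simple_or (cs := cs) v i with hl | hl
    · exact ⟨Sum.inl ⟨v, hl, (hF v hv).1 hl⟩, Finset.mem_univ _, rfl⟩
    · exact ⟨Sum.inr ⟨v * cs.simple i, by simpa using hl, (hF v hv).2 hl⟩, Finset.mem_univ _,
        by simp [e]⟩
  · exact fun v _ hv => h0 v hv

theorem bruhatKernel_eq_sum_ascentsBelow {w y : W} (x : W)
    (hy : ∀ v, cs.BruhatLT v y → (cs.length v < cs.length (v * cs.simple i) → cs.BruhatLE v w) ∧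
      (cs.length (v * cs.simple i) < cs.length v → cs.BruhatLE (v * cs.simple i) w)) :
    cs.bruhatKernel x y = cs.bruhatRankKernel x y +
      (∑ v : cs.ascentsBelow i w, cs.bruhatKernel x v.1 * b * cs.bruhatRankKernel v.1 y +
      ∑ v : cs.ascentsBelow i w,
        cs.bruhatKernel x (v.1 * cs.simple i) * b *
          cs.bruhatRankKernel (v.1 * cs.simple i) y) := by
  rw [sum_ascentsBelow w (cs.bruhatIooFinset x y)
    (fun v => cs.bruhatKernel x v * b * cs.bruhatRankKernel v y)]
  · apply bruhatKernel_eq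
    intro v h1 h2
    exact (Set.Finite.mem_toFinset _).2 ⟨h1, h2⟩
  · intro v hv
    exact hy v ((Set.Finite.mem_toFinset _).1 hv).2
  · intro v hv
    by_cases h1 : cs.BruhatLT x v
    · rw [bruhatRankKernel_of_not_lt, mul_zero]
      exact fun h2 => hv ((Set.Finite.mem_toFinset _).2 ⟨h1, h2⟩)
    · rw [bruhatKernel_of_not_lt h1, zero_mul, zero_mul]

theorem bruhatKernel_eq_sum_of_mem (x : W) {w v : W} (hv : v ∈ cs.ascentsBelow i w) :
    cs.bruhatKernel x v = cs.bruhatRankKernel x v +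
      (∑ z : cs.ascentsBelow i w, cs.bruhatKernel x z.1 * b * cs.bruhatRankKernel z.1 v +
      ∑ z : cs.ascentsBelow i w,
        cs.bruhatKernel x (z.1 * cs.simple i) * b *
          cs.bruhatRankKernel (z.1 * cs.simple i) v) := by
  apply bruhatKernel_eq_sum_ascentsBelow
  intro z hz
  exact ⟨fun _ => hz.1.trans hv.2, fun h => (mul_simple_bruhatLE h).trans (hz.1.trans hv.2)⟩

theorem bruhatKernel_mul_simple_eq_sum_of_mem (x : W) {w v : W} (hv : v ∈ cs.ascentsBelow i w) :
    cs.bruhatKernel x (v * cs.simple i) = cs.bruhatRankKernel x (v * cs.simple i) +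
      (∑ z : cs.ascentsBelow i w,
        cs.bruhatKernel x z.1 * b * cs.bruhatRankKernel z.1 (v * cs.simple i) +
      ∑ z : cs.ascentsBelow i w,
        cs.bruhatKernel x (z.1 * cs.simple i) * b *
          cs.bruhatRankKernel (z.1 * cs.simple i) (v * cs.simple i)) := by
  apply bruhatKernel_eq_sum_ascentsBelow
  intro z hz
  exact ⟨fun h => (hz.1.of_le_mul_simple hv.1 h).trans hv.2,
    fun h => (hz.1.mul_simple_le_of_le_mul_simple hv.1 h).trans hv.2⟩

theorem bruhatRankKernel_commute (u w : W) :
    (a - b) * cs.bruhatRankKernel u w = cs.bruhatRankKernel u w * (a - b) := by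
  by_cases h : cs.BruhatLT u w
  · rw [bruhatRankKernel_of_lt h, ← pow_succ, ← pow_succ']
  · simp [bruhatRankKernel_of_not_lt h]

open scoped Classical in
-- The kernel recursion is written in blocks along J and Js, and the discrepancies are killed by
-- triangularity; the result is read off at the entry (u, w).
theorem bruhatKernel_mul_simple_aux {u w : W} (hu : cs.length u < cs.length (u * cs.simple i))
    (hw : cs.length w < cs.length (w * cs.simple i)) (huw : cs.BruhatLE u w) :
    cs.bruhatKernel u (w * cs.simple i) = (if u = w then 1 else 0) + b * cs.bruhatKernel u w +
      cs.bruhatKernel u w * a +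
      ∑ v : cs.ascentsBelow i w, cs.bruhatKernel u v.1 * (a * b) * cs.bruhatKernel v.1 w -
      ∑ v : cs.ascentsBelow i w, cs.bruhatKernel u (v.1 * cs.simple i) * (b * a) *
        cs.bruhatKernel (v.1 * cs.simple i) w ∧
    cs.bruhatKernel (u * cs.simple i) (w * cs.simple i) = cs.bruhatKernel u w +
      cs.bruhatKernel (u * cs.simple i) w * a - a * cs.bruhatKernel (u * cs.simple i) w +
      ∑ v : cs.ascentsBelow i w,
        cs.bruhatKernel (u * cs.simple i) v.1 * (a * b) * cs.bruhatKernel v.1 w -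
      ∑ v : cs.ascentsBelow i w,
        cs.bruhatKernel (u * cs.simple i) (v.1 * cs.simple i) * (b * a) *
          cs.bruhatKernel (v.1 * cs.simple i) w := by
  set J := cs.ascentsBelow i w with hJ
  set s := cs.simple i with hs
  let f : Matrix J J ABPoly := Matrix.of fun v v' => cs.bruhatRankKernel v.1 v'.1
  let g : Matrix J J ABPoly := Matrix.of fun v v' => cs.bruhatRankKernel (v.1 * s) v'.1
  let p : Matrix J J ABPoly := Matrix.of fun v v' => cs.bruhatKernel v.1 v'.1
  let q : Matrix J J ABPoly := Matrix.of fun v v' => cs.bruhatKernel v.1 (v'.1 * s)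
  let r : Matrix J J ABPoly := Matrix.of fun v v' => cs.bruhatKernel (v.1 * s) v'.1
  let t : Matrix J J ABPoly := Matrix.of fun v v' => cs.bruhatKernel (v.1 * s) (v'.1 * s)
  let α := Matrix.scalar J a
  let β := Matrix.scalar J b
  have hαβ : α - β = Matrix.scalar J (a - b) := (map_sub _ _ _).symm
  have hone : ∀ v v' : J, cs.bruhatRankKernel v.1 (v'.1 * s) =
      ((1 : Matrix J J ABPoly) + (α - β) * f) v v' := by
    intro v v'
    rw [bruhatRankKernel_mul_simple v.2.1 v'.2.1, hαβ, Matrix.add_apply, scalar_mul_apply,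
      Matrix.one_apply]
    simp only [Subtype.ext_iff]
    rfl
  have hone' : ∀ v v' : J, cs.bruhatRankKernel (v.1 * s) (v'.1 * s) = f v v' := fun v v' =>
    bruhatRankKernel_mul_simple_mul_simple v.2.1 v'.2.1
  have hsum : ∀ (N N₁ N₂ X₁ X₂ : Matrix J J ABPoly) (v v' : J),
      (N + X₁ * β * N₁ + X₂ * β * N₂) v v' = N v v' +
        (∑ z, X₁ v z * b * N₁ z v' + ∑ z, X₂ v z * b * N₂ z v') := by
    intro N N₁ N₂ X₁ X₂ v v'
    rw [add_assoc, Matrix.add_apply, Matrix.add_apply, mul_scalar_mul_apply, mul_scalar_mul_apply]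
  have hp : p = f + p * β * f + q * β * g := by
    ext v v'
    rw [hsum]
    exact bruhatKernel_eq_sum_of_mem v.1 v'.2
  have hr : r = g + r * β * f + t * β * g := by
    ext v v'
    rw [hsum]
    exact bruhatKernel_eq_sum_of_mem (v.1 * s) v'.2
  have hq : q = 1 + (α - β) * f + p * β * (1 + (α - β) * f) + q * β * f := by
    ext v v'
    rw [hsum]
    refine (bruhatKernel_mul_simple_eq_sum_of_mem v.1 v'.2).trans ?_
    simp only [← hs, hone, hone']
    rfl
  have ht : t = f + r * β * (1 + (α - β) * f) + t * β * f := by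
    ext v v'
    rw [hsum]
    refine (bruhatKernel_mul_simple_eq_sum_of_mem (v.1 * s) v'.2).trans ?_
    simp only [← hs, hone, hone']
    rfl
  have hf : (α - β) * f = f * (α - β) := by
    ext v v'
    rw [hαβ, scalar_mul_apply, mul_scalar_apply]
    exact bruhatRankKernel_commute _ _
  have hg : (α - β) * g = g * (α - β) := by
    ext v v'
    rw [hαβ, scalar_mul_apply, mul_scalar_apply]
    exact bruhatRankKernel_commute _ _
  obtain ⟨h1, h2, h3, h4⟩ := block_identities hp hq hr ht hf hg rfl rfl rfl rfl
  have hf0 : ∀ v v' : J, ¬ cs.length v.1 < cs.length v'.1 → f v v' = 0 := fun v v' h =>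
    bruhatRankKernel_of_not_lt fun h' => h h'.length_lt
  -- The block g is strictly triangular for the length on J, since vs < v' and v < vs.
  have hg0 : ∀ v v' : J, ¬ cs.length v.1 < cs.length v'.1 → g v v' = 0 := fun v v' h =>
    bruhatRankKernel_of_not_lt fun h' => h (v.2.1.trans h'.length_lt)
  have hz := eq_zero_of_block_recursion (fun v : J => cs.length v.1) (a - b) b hf0 hg0 h1
    (by rw [← hαβ]; exact h2)
  have hz' := eq_zero_of_block_recursion (fun v : J => cs.length v.1) (a - b) b hf0 hg0 h3
    (by rw [← hαβ]; exact h4)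
  rw [sub_eq_zero] at hz hz'
  have hprod : ∀ (N N' : Matrix J J ABPoly) (x y : ABPoly) (v v' : J),
      (N * Matrix.scalar J x * Matrix.scalar J y * N') v v' =
        ∑ z, N v z * (x * y) * N' z v' := by
    intro N N' x y v v'
    rw [mul_assoc N, ← map_mul, mul_scalar_mul_apply]
  have huJ : u ∈ J := ⟨hu, huw⟩
  have hwJ : w ∈ J := ⟨hw, BruhatLE.refl cs w⟩
  constructor
  · have := (congrFun (congrFun hz ⟨u, huJ⟩) ⟨w, hwJ⟩).symm
    simp only [Matrix.add_apply, Matrix.sub_apply, hprod, α, β, scalar_mul_apply,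
      mul_scalar_apply, Matrix.one_apply, Subtype.mk.injEq] at this
    exact this
  · have := (congrFun (congrFun hz' ⟨u, huJ⟩) ⟨w, hwJ⟩).symm
    simp only [Matrix.add_apply, Matrix.sub_apply, hprod, α, β, scalar_mul_apply,
      mul_scalar_apply] at this
    exact this

theorem bruhatKernel_prod_eq_zero {x v w : W} (h : ¬ (cs.BruhatLT x v ∧ cs.BruhatLT v w))
    (e : ABPoly) : cs.bruhatKernel x v * e * cs.bruhatKernel v w = 0 := by
  rcases not_and_or.1 h with h | h
  · rw [bruhatKernel_of_not_lt h, zero_mul, zero_mul]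
  · rw [bruhatKernel_of_not_lt h, mul_zero]

theorem mem_bruhatIooFinset {x v w : W} :
    v ∈ cs.bruhatIooFinset x w ↔ cs.BruhatLT x v ∧ cs.BruhatLT v w :=
  Set.Finite.mem_toFinset _

theorem mem_bruhatIooDescents {x v w : W} : v ∈ cs.bruhatIooDescents x w (cs.simple i) ↔
    (cs.BruhatLT x v ∧ cs.BruhatLT v w) ∧ cs.length (v * cs.simple i) < cs.length v := by
  simp only [bruhatIooDescents, Finset.mem_filter, mem_bruhatIooFinset, mul_simple_bruhatLT_iff]

/-- Ascents carry ab and descents carry −ba = ab − d, so ab can be summed over the whole open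
interval once d is subtracted at the descents. -/
theorem sum_ascentsBelow_sub (x w : W) :
    ∑ v : cs.ascentsBelow i w, cs.bruhatKernel x v.1 * (a * b) * cs.bruhatKernel v.1 w -
      ∑ v : cs.ascentsBelow i w, cs.bruhatKernel x (v.1 * cs.simple i) * (b * a) *
        cs.bruhatKernel (v.1 * cs.simple i) w =
      ∑ v ∈ cs.bruhatIooFinset x w, cs.bruhatKernel x v * (a * b) * cs.bruhatKernel v w -
      ∑ v ∈ cs.bruhatIooDescents x w (cs.simple i),
        cs.bruhatKernel x v * d * cs.bruhatKernel v w := by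
  classical
  have h := sum_ascentsBelow (cs := cs) (i := i) w (cs.bruhatIooFinset x w)
    (fun v => if cs.length v < cs.length (v * cs.simple i) then
      cs.bruhatKernel x v * (a * b) * cs.bruhatKernel v w
      else -(cs.bruhatKernel x v * (b * a) * cs.bruhatKernel v w)) ?_ ?_
  · have h1 : ∀ v : cs.ascentsBelow i w,
        cs.length v.1 < cs.length (v.1 * cs.simple i) := fun v => v.2.1
    have h2 : ∀ v : cs.ascentsBelow i w, ¬ cs.length (v.1 * cs.simple i) <
        cs.length (v.1 * cs.simple i * cs.simple i) := fun v => by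
      rw [simple_mul_simple_cancel_right]; exact v.2.1.not_gt
    simp only [h1, h2, if_true, if_false, Finset.sum_neg_distrib, ← sub_eq_add_neg] at h
    rw [h]
    have h3 : cs.bruhatIooDescents x w (cs.simple i) =
        {v ∈ cs.bruhatIooFinset x w | ¬ cs.length v < cs.length (v * cs.simple i)} := by
      ext v
      rw [mem_bruhatIooDescents, Finset.mem_filter, mem_bruhatIooFinset, not_lt]
      rcases length_lt_mul_simple_or (cs := cs) v i with hl | hl
      · simp [hl, hl.not_gt]
      · simp [hl, hl.le]
    rw [h3, Finset.sum_filter, ← Finset.sum_sub_distrib]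
    refine Finset.sum_congr rfl fun v _ => ?_
    by_cases hl : cs.length v < cs.length (v * cs.simple i)
    · simp [hl]
    · simp only [hl, if_false, not_false_eq_true, if_true, d]
      noncomm_ring
  · intro v hv
    rw [mem_bruhatIooFinset] at hv
    exact ⟨fun _ => hv.2.1, fun hl => (mul_simple_bruhatLE hl).trans hv.2.1⟩
  · intro v hv
    rw [mem_bruhatIooFinset] at hv
    rw [bruhatKernel_prod_eq_zero hv, bruhatKernel_prod_eq_zero hv]
    simp

open scoped Classical in
theorem bruhatKernel_mul_simple_right {u w : W} (hu : cs.length u < cs.length (u * cs.simple i))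
    (hw : cs.length w < cs.length (w * cs.simple i)) (huw : cs.BruhatLE u w) :
    cs.bruhatKernel u (w * cs.simple i) = (if u = w then 1 else 0) + b * cs.bruhatKernel u w +
      cs.bruhatKernel u w * a +
      ∑ v ∈ cs.bruhatIooFinset u w, cs.bruhatKernel u v * (a * b) * cs.bruhatKernel v w -
      ∑ v ∈ cs.bruhatIooDescents u w (cs.simple i),
        cs.bruhatKernel u v * d * cs.bruhatKernel v w := by
  rw [(bruhatKernel_mul_simple_aux hu hw huw).1, add_sub_assoc, sum_ascentsBelow_sub,
    ← add_sub_assoc]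

theorem bruhatKernel_mul_simple_mul_simple {u w : W}
    (hu : cs.length u < cs.length (u * cs.simple i))
    (hw : cs.length w < cs.length (w * cs.simple i)) (huw : cs.BruhatLE u w) :
    cs.bruhatKernel (u * cs.simple i) (w * cs.simple i) = cs.bruhatKernel u w +
      cs.bruhatKernel (u * cs.simple i) w * a - a * cs.bruhatKernel (u * cs.simple i) w +
      ∑ v ∈ cs.bruhatIooFinset (u * cs.simple i) w,
        cs.bruhatKernel (u * cs.simple i) v * (a * b) * cs.bruhatKernel v w -
      ∑ v ∈ cs.bruhatIooDescents (u * cs.simple i) w (cs.simple i),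
        cs.bruhatKernel (u * cs.simple i) v * d * cs.bruhatKernel v w := by
  rw [(bruhatKernel_mul_simple_aux hu hw huw).2, add_sub_assoc, sum_ascentsBelow_sub,
    ← add_sub_assoc]

end CoxeterSystem

/-! ### The derivation of the pyramid operation and the symmetry of Eulerian posets -/

theorem eq_zero_of_recursion {n : Type*} [Fintype n] [DecidableEq n] (ℓ : n → ℕ)
    {z f : Matrix n n ABPoly} (b : ABPoly) (hf : ∀ i j, ¬ ℓ i < ℓ j → f i j = 0)
    (hz : z = z * Matrix.scalar n b * f) : z = 0 := by
  have key : ∀ k, ∀ i j, ℓ j = k → z i j = 0 := by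
    intro k
    induction k using Nat.strong_induction_on with
    | _ k ih =>
      rintro i j rfl
      rw [hz, mul_scalar_mul_apply, Finset.sum_eq_zero]
      intro m _
      by_cases hm : ℓ m < ℓ j
      · rw [ih _ hm i m rfl, zero_mul, zero_mul]
      · rw [hf _ _ hm, mul_zero]
  ext i j
  exact key _ i j rfl

section Ring

variable {R : Type*} [Ring R] {a b f f' p : R}

/-- With formal inverses, p⁻¹ = f⁻¹ − b, while the second hypothesis reads f'⁻¹ − f⁻¹ = a − b; hence
p⁻¹ = f'⁻¹ − a. -/
theorem opposite_recursion (hp : p = f + p * b * f) (hff : f - f' = f * (a - b) * f') :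
    p = f' + p * a * f' := by
  have h0 : f + p * b * f - p = 0 := sub_eq_zero.2 hp.symm
  have h1 : f - f' - f * (a - b) * f' = 0 := sub_eq_zero.2 hff
  have h : f' + p * a * f' - p = (f + p * b * f - p) - (f - f' - f * (a - b) * f') -
      p * b * (f - f' - f * (a - b) * f') - (f + p * b * f - p) * (a - b) * f' := by
    noncomm_ring
  rw [h0, h1] at h
  simp only [mul_zero, zero_mul, sub_zero] at h
  exact (sub_eq_zero.1 h).symm

theorem symmetry_recursion (hp : p = f' + p * a * f') (hf : (a - b) * f' = f' * (a - b)) :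
    (b * p + p * a + p * (a * b) * p - (a * p + p * b + p * (b * a) * p)) * a * f' =
      b * p + p * a + p * (a * b) * p - (a * p + p * b + p * (b * a) * p) := by
  have h0 : f' + p * a * f' - p = 0 := sub_eq_zero.2 hp.symm
  have h1 : (a - b) * f' - f' * (a - b) = 0 := sub_eq_zero.2 hf
  have h : (b * p + p * a + p * (a * b) * p - (a * p + p * b + p * (b * a) * p)) * a * f' -
      (b * p + p * a + p * (a * b) * p - (a * p + p * b + p * (b * a) * p)) =
      -((a - b) * (f' + p * a * f' - p)) + p * (a * b) * (f' + p * a * f' - p) -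
      p * (b * a) * (f' + p * a * f' - p) + (f' + p * a * f' - p) * (a - b) +
      ((a - b) * f' - f' * (a - b)) + p * a * ((a - b) * f' - f' * (a - b)) := by
    noncomm_ring
  rw [h0, h1] at h
  simp only [mul_zero, zero_mul, sub_zero, neg_zero, add_zero] at h
  exact sub_eq_zero.1 h

/-- Here g stands for the derivative of p, and its hypothesis is the Leibniz rule applied to the
recursion for p. The error of the closed formula solves a homogeneous recursion. -/
theorem derivation_recursion {g : R} (hp : p = f + p * b * f)
    (hg : g = b * f - f * b + (g * b * f + p * (a * b) * f + p * b * (b * f - f * b))) :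
    g - (b * p - p * b + p * (a * b) * p) =
      (g - (b * p - p * b + p * (a * b) * p)) * b * f := by
  have h0 : f + p * b * f - p = 0 := sub_eq_zero.2 hp.symm
  have h1 : b * f - f * b + (g * b * f + p * (a * b) * f + p * b * (b * f - f * b)) - g = 0 :=
    sub_eq_zero.2 hg.symm
  have h : (g - (b * p - p * b + p * (a * b) * p)) * b * f -
      (g - (b * p - p * b + p * (a * b) * p)) =
      (b * f - f * b + (g * b * f + p * (a * b) * f + p * b * (b * f - f * b)) - g) -
      b * (f + p * b * f - p) - p * (a * b) * (f + p * b * f - p) +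
      (f + p * b * f - p) * b := by
    noncomm_ring
  rw [h0, h1] at h
  simp only [mul_zero, zero_mul, sub_zero, add_zero] at h
  exact (sub_eq_zero.1 h).symm

end Ring

/-! ### The derivation a ↦ ba, b ↦ ab of the free algebra -/

namespace ABPoly

/-- A derivation of the free algebra, in the upper right corner of a triangular matrix. -/
noncomputable def derivationHom : ABPoly →ₐ[ℚ] Matrix (Fin 2) (Fin 2) ABPoly :=
  FreeAlgebra.lift ℚ ![!![a, b * a; 0, a], !![b, a * b; 0, b]]

/-- The derivation with `a ↦ b a` and `b ↦ a b`. -/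
noncomputable def derivation (x : ABPoly) : ABPoly := derivationHom x 0 1

theorem derivationHom_a : derivationHom a = !![a, b * a; 0, a] := by
  simp [derivationHom, a]

theorem derivationHom_b : derivationHom b = !![b, a * b; 0, b] := by
  simp [derivationHom, b]

theorem derivationHom_diag (x : ABPoly) :
    derivationHom x 0 0 = x ∧ derivationHom x 1 0 = 0 ∧ derivationHom x 1 1 = x := by
  induction x using FreeAlgebra.induction with
  | grade0 r =>
    rw [AlgHom.commutes]
    simp [Matrix.algebraMap_matrix_apply]
  | grade1 i =>
    fin_cases i
    · change derivationHom a 0 0 = a ∧ _ ∧ derivationHom a 1 1 = a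
      rw [show derivationHom (FreeAlgebra.ι ℚ ((fun i => i) (⟨0, by omega⟩ : Fin 2))) =
        !![a, b * a; 0, a] from derivationHom_a, derivationHom_a]
      simp
    · change derivationHom b 0 0 = b ∧ _ ∧ derivationHom b 1 1 = b
      rw [show derivationHom (FreeAlgebra.ι ℚ ((fun i => i) (⟨1, by omega⟩ : Fin 2))) =
        !![b, a * b; 0, b] from derivationHom_b, derivationHom_b]
      simp
  | mul x y hx hy =>
    simp [map_mul, Matrix.mul_apply, Fin.sum_univ_two, hx, hy]
  | add x y hx hy =>
    simp [map_add, hx, hy]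

theorem derivation_mul (x y : ABPoly) :
    derivation (x * y) = derivation x * y + x * derivation y := by
  rw [derivation, map_mul, Matrix.mul_apply, Fin.sum_univ_two, (derivationHom_diag x).1,
    (derivationHom_diag y).2.2, add_comm]
  rfl

theorem derivation_add (x y : ABPoly) : derivation (x + y) = derivation x + derivation y := by
  simp [derivation]

theorem derivation_sub (x y : ABPoly) : derivation (x - y) = derivation x - derivation y := by
  simp [derivation]

theorem derivation_neg (x : ABPoly) : derivation (-x) = -derivation x := by
  simp [derivation]

theorem derivation_zero : derivation 0 = 0 := by simp [derivation]

theorem derivation_one : derivation 1 = 0 := by simp [derivation]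

theorem derivation_sum {ι : Type*} (s : Finset ι) (f : ι → ABPoly) :
    derivation (∑ i ∈ s, f i) = ∑ i ∈ s, derivation (f i) := by
  classical
  induction s using Finset.induction_on with
  | empty => simp [derivation_zero]
  | insert i s hi ih => rw [Finset.sum_insert hi, Finset.sum_insert hi, derivation_add, ih]

theorem derivation_a : derivation a = b * a := by simp [derivation, derivationHom_a]

theorem derivation_b : derivation b = a * b := by simp [derivation, derivationHom_b]

/-- On a − b the derivation coincides with the commutator with b, hence also on its powers; this
makes the derivative of the rank kernel explicit. -/
theorem derivation_sub_pow (k : ℕ) :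
    derivation ((a - b) ^ k) = b * (a - b) ^ k - (a - b) ^ k * b := by
  induction k with
  | zero => simp [derivation_one]
  | succ k ih =>
    rw [pow_succ, derivation_mul, ih, derivation_sub, derivation_a, derivation_b]
    noncomm_ring

theorem c_mem : c ∈ cdPolynomials := Subring.subset_closure (by simp)

theorem d_mem : d ∈ cdPolynomials := Subring.subset_closure (by simp)

theorem derivation_mem {x : ABPoly} (hx : x ∈ cdPolynomials) : derivation x ∈ cdPolynomials := by
  unfold cdPolynomials at hx
  induction hx using Subring.closure_induction with
  | mem x hx =>
    rcases hx with rfl | rfl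
    · have : derivation c = d := by
        rw [c, derivation_add, derivation_a, derivation_b, d, add_comm]
      rw [this]
      exact d_mem
    · have : derivation d = c * d := by
        rw [d, derivation_add, derivation_mul, derivation_mul, derivation_a, derivation_b, c]
        noncomm_ring
      rw [this]
      exact mul_mem c_mem d_mem
  | zero => rw [derivation_zero]; exact zero_mem _
  | one => rw [derivation_one]; exact zero_mem _
  | add x y _ _ hx hy => rw [derivation_add]; exact add_mem hx hy
  | neg x _ hx => rw [derivation_neg]; exact neg_mem hx
  | mul x y hx' hy' hx hy =>
    rw [derivation_mul]
    exact add_mem (mul_mem hx hy') (mul_mem hx' hy)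

end ABPoly

section Kernels

variable {P : Type*} [PartialOrder P]

theorem derivation_rankKernel (ρ : P → ℕ) (x y : P) :
    derivation (rankKernel ρ x y) = b * rankKernel ρ x y - rankKernel ρ x y * b := by
  by_cases h : x < y
  · rw [rankKernel_of_lt ρ h, derivation_sub_pow]
  · simp [rankKernel_of_not_lt ρ h, derivation_zero]

variable [Fintype P]

theorem IsIndexKernel.derivation_eq {ρ : P → ℕ} {Ψ : Matrix P P ABPoly} (h : IsIndexKernel ρ Ψ)
    (hρ : StrictMono ρ) (x y : P) :
    derivation (Ψ x y) = b * Ψ x y - Ψ x y * b + ∑ z, Ψ x z * (a * b) * Ψ z y := by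
  classical
  set g : Matrix P P ABPoly := Matrix.of fun x y => derivation (Ψ x y) with hgdef
  have hg : g = Matrix.scalar P b * rankKernel ρ - rankKernel ρ * Matrix.scalar P b +
      (g * Matrix.scalar P b * rankKernel ρ +
        Ψ * (Matrix.scalar P a * Matrix.scalar P b) * rankKernel ρ +
        Ψ * Matrix.scalar P b *
          (Matrix.scalar P b * rankKernel ρ - rankKernel ρ * Matrix.scalar P b)) := by
    ext x y
    simp only [← map_mul, Matrix.add_apply, Matrix.sub_apply, mul_scalar_mul_apply,
      scalar_mul_apply, mul_scalar_apply]
    rw [hgdef, Matrix.of_apply, h.eq, derivation_add, derivation_sum, derivation_rankKernel,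
      ← Finset.sum_add_distrib, ← Finset.sum_add_distrib]
    congr 1
    refine Finset.sum_congr rfl fun z _ => ?_
    rw [derivation_mul, derivation_mul, derivation_b, derivation_rankKernel, add_mul]
    rfl
  have := eq_zero_of_recursion ρ b (fun i j hij => rankKernel_of_not_lt ρ fun h' => hij (hρ h'))
    (derivation_recursion h.matrix_eq hg)
  rw [sub_eq_zero] at this
  have := congrFun (congrFun this x) y
  simp only [← map_mul, Matrix.add_apply, Matrix.sub_apply, mul_scalar_mul_apply,
      scalar_mul_apply, mul_scalar_apply] at this
  exact this

/-- The symmetry of the `ab`-index of an Eulerian poset, in the form that makes the pyramid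
formula symmetric in `a` and `b`. -/
theorem IsIndexKernel.symmetry {ρ : P → ℕ} {Ψ f' : Matrix P P ABPoly} (h : IsIndexKernel ρ Ψ)
    (hf0 : ∀ x y, ¬ ρ x < ρ y → f' x y = 0)
    (hcomm : ∀ x y, (a - b) * f' x y = f' x y * (a - b))
    (hff : ∀ x y, rankKernel ρ x y - f' x y = ∑ z, rankKernel ρ x z * (a - b) * f' z y) (x y : P) :
    b * Ψ x y + Ψ x y * a + ∑ z, Ψ x z * (a * b) * Ψ z y =
      a * Ψ x y + Ψ x y * b + ∑ z, Ψ x z * (b * a) * Ψ z y := by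
  classical
  have h1 : Ψ = f' + Ψ * Matrix.scalar P a * f' := by
    refine opposite_recursion h.matrix_eq ?_
    ext x y
    rw [← map_sub, mul_scalar_mul_apply, Matrix.sub_apply, hff]
  have h2 : (Matrix.scalar P a - Matrix.scalar P b) * f' =
      f' * (Matrix.scalar P a - Matrix.scalar P b) := by
    ext x y
    rw [← map_sub, scalar_mul_apply, mul_scalar_apply, hcomm]
  have h3 := eq_zero_of_recursion ρ a hf0 (symmetry_recursion h1 h2).symm
  rw [sub_eq_zero] at h3
  have := congrFun (congrFun h3 x) y
  simp only [← map_mul, Matrix.add_apply, mul_scalar_mul_apply,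
      scalar_mul_apply, mul_scalar_apply] at this
  exact this

end Kernels

/-! ### The Eulerian property and the exchange of a and b -/

namespace CoxeterSystem

variable {B W : Type*} [Group W] {M : CoxeterMatrix B} {cs : CoxeterSystem M W}

theorem neg_one_pow_length_mul_simple (v : W) (i : B) :
    (-1 : ℤ) ^ cs.length (v * cs.simple i) = -(-1) ^ cs.length v := by
  rcases cs.length_mul_simple v i with h | h
  · rw [h, pow_succ, mul_neg_one]
  · rw [← h, pow_succ, mul_neg_one, neg_neg]

/-- Bruhat intervals are Eulerian. -/
theorem sum_neg_one_pow_length {u w : W} (hne : u ≠ w) :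
    ∑ v ∈ (cs.finite_bruhatIcc u w).toFinset, (-1 : ℤ) ^ cs.length v = 0 := by
  classical
  induction hn : cs.length w using Nat.strong_induction_on generalizing u w with
  | _ n ih =>
    subst hn
    by_cases huw : cs.BruhatLE u w
    swap
    · rw [Finset.sum_eq_zero]
      intro v hv
      rw [Set.Finite.mem_toFinset] at hv
      exact absurd (hv.1.trans hv.2) huw
    have hw1 : w ≠ 1 := by
      rintro rfl
      have := huw.length_lt hne
      simp at this
    obtain ⟨i, hi⟩ := cs.exists_rightDescent_of_ne_one hw1
    obtain ⟨w, rfl⟩ : ∃ w', w = w' * cs.simple i := ⟨w * cs.simple i, by simp⟩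
    have hi : cs.length w < cs.length (w * cs.simple i) := by
      simpa [IsRightDescent] using hi
    -- If u goes up under s and the top goes down, right multiplication by s is a sign-reversing
    -- involution of the interval.
    have hasc : ∀ u, cs.length u < cs.length (u * cs.simple i) →
        ∑ v ∈ (cs.finite_bruhatIcc u (w * cs.simple i)).toFinset, (-1 : ℤ) ^ cs.length v = 0 := by
      intro u hu
      apply Finset.sum_involution (fun v _ => v * cs.simple i)
      · intro v _
        rw [neg_one_pow_length_mul_simple]
        ring
      · intro v _ _ h
        have := cs.length_mul_simple_ne v i
        rw [h] at this
        exact this rfl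
      · intro v hv
        rw [Set.Finite.mem_toFinset] at hv ⊢
        refine ⟨?_, hv.2.mul_simple_le (by simpa using hi)⟩
        rcases length_lt_mul_simple_or (cs := cs) v i with hl | hl
        · exact hv.1.trans (bruhatLE_mul_simple hl)
        · have h1 : cs.BruhatLE u (v * cs.simple i * cs.simple i) := by simpa using hv.1
          exact h1.of_le_mul_simple (by simpa using hl) hu
      · intro v _
        simp
    rcases length_lt_mul_simple_or (cs := cs) u i with hu | hu
    · exact hasc u hu
    obtain ⟨u, rfl⟩ : ∃ u', u = u' * cs.simple i := ⟨u * cs.simple i, by simp⟩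
    rw [simple_mul_simple_cancel_right] at hu
    have huw' : u ≠ w := fun h => hne (by rw [h])
    have huw'' : u * cs.simple i ≠ w := by
      rintro rfl
      rw [simple_mul_simple_cancel_right] at hi
      omega
    have h1 := hasc u hu
    have h2 := ih _ hi huw' rfl
    have h3 := ih _ hi huw'' rfl
    have hsplit : ∀ y : W,
        ∑ v ∈ (cs.finite_bruhatIcc (u * cs.simple i) y).toFinset, (-1 : ℤ) ^ cs.length v +
        ∑ v ∈ (cs.finite_bruhatIcc u y).toFinset with ¬ cs.BruhatLE (u * cs.simple i) v,
          (-1 : ℤ) ^ cs.length v =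
        ∑ v ∈ (cs.finite_bruhatIcc u y).toFinset, (-1 : ℤ) ^ cs.length v := by
      intro y
      rw [← Finset.sum_filter_add_sum_filter_not (cs.finite_bruhatIcc u y).toFinset
        (fun v => cs.BruhatLE (u * cs.simple i) v)]
      congr 2
      ext v
      simp only [Set.Finite.mem_toFinset, Finset.mem_filter]
      exact ⟨fun h => ⟨⟨(bruhatLE_mul_simple hu).trans h.1, h.2⟩, h.1⟩,
        fun h => ⟨h.2, h.1.2⟩⟩
    -- The elements above u but not above us are ascents, so lifting makes them the same below ws as
    -- below w. Hence the sum over [us, ws] is a combination of three sums already known to vanish.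
    have hfil : (cs.finite_bruhatIcc u (w * cs.simple i)).toFinset.filter
          (fun v => ¬ cs.BruhatLE (u * cs.simple i) v) =
        (cs.finite_bruhatIcc u w).toFinset.filter
          (fun v => ¬ cs.BruhatLE (u * cs.simple i) v) := by
      ext v
      simp only [Set.Finite.mem_toFinset, Finset.mem_filter]
      refine ⟨fun h => ⟨⟨h.1.1, ?_⟩, h.2⟩,
        fun h => ⟨⟨h.1.1, h.1.2.trans (bruhatLE_mul_simple hi)⟩, h.2⟩⟩
      rcases length_lt_mul_simple_or (cs := cs) v i with hl | hl
      · exact h.1.2.of_le_mul_simple hi hl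
      · exact absurd (h.1.1.mul_simple_le hl) h.2
    have h4 := hsplit (w * cs.simple i)
    have h5 := hsplit w
    rw [hfil] at h4
    linarith

theorem sum_bruhatIoo_neg_one_pow_length {u w : W} (h : cs.BruhatLT u w) :
    ∑ v ∈ cs.bruhatIooFinset u w, (-1 : ℤ) ^ cs.length v =
      -(-1) ^ cs.length u - (-1) ^ cs.length w := by
  classical
  have h1 := sum_neg_one_pow_length (cs := cs) h.2
  have h2 : (cs.finite_bruhatIcc u w).toFinset = insert u (insert w (cs.bruhatIooFinset u w)) := by
    ext v
    simp only [Set.Finite.mem_toFinset, Finset.mem_insert, mem_bruhatIooFinset]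
    constructor
    · intro hv
      by_cases hu : u = v
      · exact Or.inl hu.symm
      by_cases hw : v = w
      · exact Or.inr (Or.inl hw)
      exact Or.inr (Or.inr ⟨⟨hv.1, hu⟩, ⟨hv.2, hw⟩⟩)
    · rintro (rfl | rfl | hv)
      · exact ⟨BruhatLE.refl cs _, h.1⟩
      · exact ⟨h.1, BruhatLE.refl cs _⟩
      · exact ⟨hv.1.1, hv.2.1⟩
  rw [h2, Finset.sum_insert, Finset.sum_insert] at h1
  · linarith
  · rw [mem_bruhatIooFinset]
    exact fun h' => h'.2.2 rfl
  · rw [Finset.mem_insert, mem_bruhatIooFinset]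
    rintro (rfl | h')
    · exact h.2 rfl
    · exact h'.1.2 rfl

open scoped Classical in
/-- The analogue of `bruhatRankKernel` with `a` and `b` exchanged. -/
noncomputable def bruhatRankKernelSwap (cs : CoxeterSystem M W) (u w : W) : ABPoly :=
  if cs.BruhatLT u w then (b - a) ^ (cs.length w - cs.length u - 1) else 0

/-- All summands are the same power of a − b up to the sign (−1)^{ℓ(v)}, so the identity is the
Eulerian relation for the open interval. -/
theorem bruhatRankKernel_sub_swap (u w : W) :
    cs.bruhatRankKernel u w - cs.bruhatRankKernelSwap u w =
      ∑ v ∈ cs.bruhatIooFinset u w,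
        cs.bruhatRankKernel u v * (a - b) * cs.bruhatRankKernelSwap v w := by
  by_cases h : cs.BruhatLT u w
  · have hl := h.length_lt
    have hpow : ∀ k, (b - a) ^ k = ((-1 : ℤ) ^ k) • (a - b) ^ k := by
      intro k
      rw [← neg_sub, neg_pow, zsmul_eq_mul]
      push_cast
      rfl
    have hterm : ∀ v ∈ cs.bruhatIooFinset u w,
        cs.bruhatRankKernel u v * (a - b) * cs.bruhatRankKernelSwap v w =
        (-(-1) ^ cs.length w * (-1 : ℤ) ^ cs.length v) •
          (a - b) ^ (cs.length w - cs.length u - 1) := by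
      intro v hv
      rw [mem_bruhatIooFinset] at hv
      have h1 := hv.1.length_lt
      have h2 := hv.2.length_lt
      rw [bruhatRankKernel_of_lt hv.1, bruhatRankKernelSwap, if_pos hv.2, hpow, ← pow_succ,
        mul_smul_comm, ← pow_add]
      congr 1
      · obtain ⟨k, hk⟩ := Nat.exists_eq_add_of_lt h2
        rw [hk, show cs.length v + k + 1 - cs.length v - 1 = k by omega, pow_succ, pow_add]
        have : ((-1 : ℤ) ^ cs.length v) * (-1) ^ cs.length v = 1 := by
          rw [← pow_add, Even.neg_one_pow ⟨_, rfl⟩]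
        linear_combination -((-1) ^ k) * this
      · congr 1
        omega
    rw [Finset.sum_congr rfl hterm, ← Finset.sum_smul, ← Finset.mul_sum,
      sum_bruhatIoo_neg_one_pow_length h, bruhatRankKernel_of_lt h, bruhatRankKernelSwap,
      if_pos h, hpow]
    conv_lhs => rw [← one_zsmul ((a - b) ^ (cs.length w - cs.length u - 1)), smul_smul, mul_one,
      ← sub_smul]
    congr 1
    obtain ⟨k, hk⟩ := Nat.exists_eq_add_of_lt hl
    rw [hk, show cs.length u + k + 1 - cs.length u - 1 = k by omega, pow_succ, pow_add]
    have h1 : ((-1 : ℤ) ^ cs.length u) * (-1) ^ cs.length u = 1 := by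
      rw [← pow_add, Even.neg_one_pow ⟨_, rfl⟩]
    have h2 : ((-1 : ℤ) ^ k) * (-1) ^ k = 1 := by
      rw [← pow_add, Even.neg_one_pow ⟨_, rfl⟩]
    linear_combination ((-1) ^ k - (-1 : ℤ) ^ k * (-1) ^ k) * h1 - h2
  · rw [bruhatRankKernel_of_not_lt h, bruhatRankKernelSwap, if_neg h, Finset.sum_eq_zero, sub_zero]
    intro v hv
    rw [mem_bruhatIooFinset] at hv
    exact absurd (hv.1.trans_le hv.2.1) h

theorem sum_bruhatIcc_kernel {u w : W} (x y : cs.bruhatIcc u w) (e : ABPoly) :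
    ∑ z : cs.bruhatIcc u w, cs.bruhatKernel x.1 z.1 * e * cs.bruhatKernel z.1 y.1 =
      ∑ v ∈ cs.bruhatIooFinset x.1 y.1, cs.bruhatKernel x.1 v * e * cs.bruhatKernel v y.1 := by
  rw [sum_bruhatIcc u w (fun v => cs.bruhatKernel x.1 v * e * cs.bruhatKernel v y.1)
    (cs.bruhatIooFinset u w) (fun v h1 h2 => mem_bruhatIooFinset.2 ⟨h1, h2⟩)]
  · symm
    apply Finset.sum_subset
    · intro v hv
      rw [mem_bruhatIooFinset] at hv ⊢
      exact ⟨BruhatLE.trans_lt x.2.1 hv.1, hv.2.trans_le y.2.2⟩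
    · intro v _ hv
      rw [mem_bruhatIooFinset] at hv
      exact bruhatKernel_prod_eq_zero hv e
  · intro v hv
    apply bruhatKernel_prod_eq_zero
    exact fun h => hv ⟨BruhatLE.trans_lt x.2.1 h.1, h.2.trans_le y.2.2⟩

theorem bruhatKernel_symmetry {u w : W} (h : cs.BruhatLE u w) :
    b * cs.bruhatKernel u w + cs.bruhatKernel u w * a +
        ∑ v ∈ cs.bruhatIooFinset u w, cs.bruhatKernel u v * (a * b) * cs.bruhatKernel v w =
      a * cs.bruhatKernel u w + cs.bruhatKernel u w * b +
        ∑ v ∈ cs.bruhatIooFinset u w, cs.bruhatKernel u v * (b * a) * cs.bruhatKernel v w := by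
  have := (isIndexKernel_bruhatKernel (cs := cs) u w).symmetry
    (f' := Matrix.of fun x y => cs.bruhatRankKernelSwap x.1 y.1) ?_ ?_ ?_
    ⟨u, BruhatLE.refl cs u, h⟩ ⟨w, h, BruhatLE.refl cs w⟩
  · simp only [Matrix.of_apply] at this
    rwa [sum_bruhatIcc_kernel ⟨u, BruhatLE.refl cs u, h⟩ ⟨w, h, BruhatLE.refl cs w⟩,
      sum_bruhatIcc_kernel ⟨u, BruhatLE.refl cs u, h⟩ ⟨w, h, BruhatLE.refl cs w⟩] at this
  · intro x y hxy
    rw [Matrix.of_apply, bruhatRankKernelSwap, if_neg]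
    exact fun h' => hxy (strictMono_bruhatRank u w (bruhatIcc_lt_iff.2 h'))
  · intro x y
    rw [Matrix.of_apply, bruhatRankKernelSwap]
    split_ifs
    · rw [← neg_sub a b, neg_pow (a - b)]
      have h1 : Commute (a - b) ((-1) ^ (cs.length y.1 - cs.length x.1 - 1)) :=
        (Commute.neg_one_right (a - b)).pow_right _
      exact (h1.mul_right (Commute.self_pow _ _)).eq
    · simp
  · intro x y
    simp only [rankKernel_bruhatRank, Matrix.of_apply]
    rw [bruhatRankKernel_sub_swap]
    have h0 : ∀ v, ¬ (cs.BruhatLT x.1 v ∧ cs.BruhatLT v y.1) →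
        cs.bruhatRankKernel x.1 v * (a - b) * cs.bruhatRankKernelSwap v y.1 = 0 := by
      intro v hv
      rcases not_and_or.1 hv with h | h
      · rw [bruhatRankKernel_of_not_lt h, zero_mul, zero_mul]
      · rw [bruhatRankKernelSwap, if_neg h, mul_zero]
    rw [sum_bruhatIcc u w
      (fun v => cs.bruhatRankKernel x.1 v * (a - b) * cs.bruhatRankKernelSwap v y.1)
      (cs.bruhatIooFinset u w) (fun v h1 h2 => mem_bruhatIooFinset.2 ⟨h1, h2⟩)]
    · apply Finset.sum_subset
      · intro v hv
        rw [mem_bruhatIooFinset] at hv ⊢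
        exact ⟨BruhatLE.trans_lt x.2.1 hv.1, hv.2.trans_le y.2.2⟩
      · intro v _ hv
        rw [mem_bruhatIooFinset] at hv
        exact h0 v hv
    · intro v hv
      apply h0
      exact fun h => hv ⟨BruhatLE.trans_lt x.2.1 h.1, h.2.trans_le y.2.2⟩

theorem derivation_bruhatKernel {u w : W} (h : cs.BruhatLE u w) :
    derivation (cs.bruhatKernel u w) = b * cs.bruhatKernel u w - cs.bruhatKernel u w * b +
      ∑ v ∈ cs.bruhatIooFinset u w, cs.bruhatKernel u v * (a * b) * cs.bruhatKernel v w := by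
  have := (isIndexKernel_bruhatKernel (cs := cs) u w).derivation_eq (strictMono_bruhatRank u w)
    ⟨u, BruhatLE.refl cs u, h⟩ ⟨w, h, BruhatLE.refl cs w⟩
  simp only [Matrix.of_apply] at this
  rwa [sum_bruhatIcc_kernel ⟨u, BruhatLE.refl cs u, h⟩ ⟨w, h, BruhatLE.refl cs w⟩] at this

end CoxeterSystem

namespace CoxeterSystem

variable {B W : Type*} [Group W] {M : CoxeterMatrix B} {cs : CoxeterSystem M W} {i : B}

/-! ### The `cd`-index of Bruhat intervals -/

theorem bruhatIndex_self (u : W) : cs.bruhatIndex u u = 1 := by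
  rw [bruhatIndex, abIndex_eq_chainSum (strictMono_bruhatRank u u)
    (posetRank_eq _ (strictMono_bruhatRank u u) bruhatRank_exists_pred)
    (bot := ⟨u, BruhatLE.refl cs u, BruhatLE.refl cs u⟩)
    (top := ⟨u, BruhatLE.refl cs u, BruhatLE.refl cs u⟩) (fun z => z.2.1) (fun z => z.2.2)
    (by simp [bruhatRank]), chainSum]
  have : openChains (⟨u, BruhatLE.refl cs u, BruhatLE.refl cs u⟩ : cs.bruhatIcc u u)
      ⟨u, BruhatLE.refl cs u, BruhatLE.refl cs u⟩ = {∅} := by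
    ext C
    rw [mem_openChains, Finset.mem_singleton]
    constructor
    · rintro ⟨-, h⟩
      rw [Finset.eq_empty_iff_forall_notMem]
      exact fun z hz => lt_irrefl _ ((h z hz).1.trans (h z hz).2)
    · rintro rfl
      simp
  rw [this, Finset.sum_singleton]
  simp [weight]

/-- Induction on the length of the top through a right descent: the recursion involves only shorter
tops, and the derivation turns its parts in a and b into expressions in c and d. -/
theorem bruhatKernel_mem_cdPolynomials (u w : W) : cs.bruhatKernel u w ∈ cdPolynomials := by
  classical
  induction hn : cs.length w using Nat.strong_induction_on generalizing u w with
  | _ n ih =>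
    subst hn
    by_cases huw : cs.BruhatLT u w
    swap
    · rw [bruhatKernel_of_not_lt huw]
      exact zero_mem _
    have hw1 : w ≠ 1 := by
      rintro rfl
      have := huw.length_lt
      simp at this
    obtain ⟨i, hi⟩ := cs.exists_rightDescent_of_ne_one hw1
    obtain ⟨w, rfl⟩ : ∃ w', w = w' * cs.simple i := ⟨w * cs.simple i, by simp⟩
    have hi : cs.length w < cs.length (w * cs.simple i) := by
      simpa [IsRightDescent] using hi
    have hsum : ∀ x, ∑ v ∈ cs.bruhatIooDescents x w (cs.simple i),
        cs.bruhatKernel x v * d * cs.bruhatKernel v w ∈ cdPolynomials := by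
      intro x
      refine sum_mem fun v hv => ?_
      rw [mem_bruhatIooDescents] at hv
      exact mul_mem (mul_mem (ih _ (hv.1.2.length_lt.trans hi) _ _ rfl) d_mem) (ih _ hi _ _ rfl)
    rcases length_lt_mul_simple_or (cs := cs) u i with hu | hu
    · have hle : cs.BruhatLE u w := huw.1.of_le_mul_simple hi hu
      have hone : (if u = w then (1 : ABPoly) else 0) ∈ cdPolynomials := by
        split_ifs
        · exact one_mem _
        · exact zero_mem _
      have := derivation_bruhatKernel hle
      rw [bruhatKernel_mul_simple_right hu hi hle]
      have heq : (if u = w then (1 : ABPoly) else 0) + b * cs.bruhatKernel u w +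
          cs.bruhatKernel u w * a +
          ∑ v ∈ cs.bruhatIooFinset u w, cs.bruhatKernel u v * (a * b) * cs.bruhatKernel v w =
          (if u = w then (1 : ABPoly) else 0) + derivation (cs.bruhatKernel u w) +
            cs.bruhatKernel u w * c := by
        rw [this, c, mul_add]
        abel
      rw [heq]
      exact sub_mem (add_mem (add_mem hone (derivation_mem (ih _ hi _ _ rfl)))
        (mul_mem (ih _ hi _ _ rfl) c_mem)) (hsum u)
    · obtain ⟨u, rfl⟩ : ∃ u', u = u' * cs.simple i := ⟨u * cs.simple i, by simp⟩
      rw [simple_mul_simple_cancel_right] at hu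
      have hle : cs.BruhatLE u w :=
        ((mul_simple_bruhatLT_mul_simple_iff hu hi).1 huw).1
      rw [bruhatKernel_mul_simple_mul_simple hu hi hle]
      set r := cs.bruhatKernel (u * cs.simple i) w with hr
      have hmem : r ∈ cdPolynomials := ih _ hi _ _ rfl
      -- Substituting ra − ar = (br − rb) + rc − cr exhibits the derivative of r.
      have heq : r * a - a * r + ∑ v ∈ cs.bruhatIooFinset (u * cs.simple i) w,
          cs.bruhatKernel (u * cs.simple i) v * (a * b) * cs.bruhatKernel v w =
          derivation r + r * c - c * r := by
        by_cases hle' : cs.BruhatLE (u * cs.simple i) w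
        · rw [derivation_bruhatKernel hle', c, mul_add, add_mul]
          abel
        · rw [hr, bruhatKernel_of_not_lt (fun h => hle' h.1), Finset.sum_eq_zero, derivation_zero]
          · simp
          · intro v hv
            rw [mem_bruhatIooFinset] at hv
            exact absurd (hv.1.1.trans hv.2.1) hle'
      rw [add_sub_assoc (cs.bruhatKernel u w), add_assoc (cs.bruhatKernel u w), heq]
      exact sub_mem (add_mem (ih _ hi _ _ rfl) (sub_mem (add_mem (derivation_mem hmem)
        (mul_mem hmem c_mem)) (mul_mem c_mem hmem))) (hsum _)

theorem bruhatIndex_mem_cdPolynomials {u w : W} (h : cs.BruhatLE u w) :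
    cs.bruhatIndex u w ∈ cdPolynomials := by
  by_cases he : u = w
  · rw [he, bruhatIndex_self]
    exact one_mem _
  · rw [← bruhatKernel_of_lt ⟨h, he⟩]
    exact bruhatKernel_mem_cdPolynomials u w

open scoped Classical in
theorem abIndex_pyr_bruhatIcc {u w : W} (h : cs.BruhatLE u w) :
    abIndex (Pyr (cs.bruhatIcc u w)) = (if u = w then 1 else 0) + b * cs.bruhatKernel u w +
      cs.bruhatKernel u w * a +
      ∑ v ∈ cs.bruhatIooFinset u w, cs.bruhatKernel u v * (a * b) * cs.bruhatKernel v w := by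
  rw [(isIndexKernel_bruhatKernel (cs := cs) u w).abIndex_pyr (strictMono_bruhatRank u w)
    bruhatRank_exists_pred (bot := ⟨u, BruhatLE.refl cs u, h⟩)
    (top := ⟨w, h, BruhatLE.refl cs w⟩) (fun z => z.2.1) (fun z => z.2.2) (by simp [bruhatRank])]
  simp only [Matrix.of_apply, mul_assoc _ a b]
  rw [sum_bruhatIcc_kernel ⟨u, BruhatLE.refl cs u, h⟩ ⟨w, h, BruhatLE.refl cs w⟩]
  by_cases he : u = w
  · subst he
    simp
  · rw [if_neg he, if_neg fun h' => he (congrArg (fun v : cs.bruhatIcc u w => v.1) h')]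

theorem abIndex_shaving_bruhatIcc {u w : W} (h : cs.BruhatLE u w) (x : cs.bruhatIcc u w)
    (hx : cs.length x.1 = cs.length u + 1) (hxw : x.1 ≠ w) :
    abIndex (Shaving x) = cs.bruhatKernel u w + cs.bruhatKernel x.1 w * a -
      a * cs.bruhatKernel x.1 w +
      ∑ v ∈ cs.bruhatIooFinset x.1 w, cs.bruhatKernel x.1 v * (a * b) * cs.bruhatKernel v w := by
  classical
  rw [(isIndexKernel_bruhatKernel (cs := cs) u w).abIndex_shaving (strictMono_bruhatRank u w)
    bruhatRank_exists_coatom (bot := ⟨u, BruhatLE.refl cs u, h⟩)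
    (top := ⟨w, h, BruhatLE.refl cs w⟩) (fun z => z.2.1) (fun z => z.2.2) (by simp [bruhatRank])
    (by simp [bruhatRank, hx]) (fun he => hxw (congrArg (fun v : cs.bruhatIcc u w => v.1) he))]
  simp only [Matrix.of_apply, mul_assoc _ a b]
  rw [sum_bruhatIcc_kernel x ⟨w, h, BruhatLE.refl cs w⟩]

theorem sum_bruhatIooFinset_kernel (u w : W) (f : W → ABPoly → ABPoly) :
    ∑ v ∈ cs.bruhatIooFinset u w, f v (cs.bruhatKernel u v * d * cs.bruhatKernel v w) =
      ∑ v ∈ cs.bruhatIooFinset u w, f v (cs.bruhatIndex u v * d * cs.bruhatIndex v w) := by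
  refine Finset.sum_congr rfl fun v hv => ?_
  rw [mem_bruhatIooFinset] at hv
  rw [bruhatKernel_of_lt hv.1, bruhatKernel_of_lt hv.2]

theorem sum_bruhatIooDescents_kernel (u w : W) :
    ∑ v ∈ cs.bruhatIooDescents u w (cs.simple i),
        cs.bruhatKernel u v * d * cs.bruhatKernel v w =
      ∑ v ∈ cs.bruhatIooDescents u w (cs.simple i),
        cs.bruhatIndex u v * d * cs.bruhatIndex v w := by
  refine Finset.sum_congr rfl fun v hv => ?_
  rw [mem_bruhatIooDescents] at hv
  rw [bruhatKernel_of_lt hv.1.1, bruhatKernel_of_lt hv.1.2]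

/-- The weight is 1 at ascents and −1 at descents, that is, 1 minus twice the indicator of a
descent. -/
theorem sum_sigma_smul (u w : W) (f : W → ABPoly) :
    ∑ v ∈ cs.bruhatIooFinset u w, cs.sigma (cs.simple i) v • f v =
      ∑ v ∈ cs.bruhatIooFinset u w, f v -
        (2 : ℚ) • ∑ v ∈ cs.bruhatIooDescents u w (cs.simple i), f v := by
  classical
  have h3 : cs.bruhatIooDescents u w (cs.simple i) =
      {v ∈ cs.bruhatIooFinset u w | cs.length (v * cs.simple i) < cs.length v} := by
    ext v
    rw [mem_bruhatIooDescents, Finset.mem_filter, mem_bruhatIooFinset]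
  rw [h3, Finset.sum_filter, Finset.smul_sum, ← Finset.sum_sub_distrib]
  refine Finset.sum_congr rfl fun v _ => ?_
  rw [sigma]
  rcases cs.length_mul_simple v i with h | h
  · rw [if_neg (by omega), h, smul_zero, sub_zero]
    push_cast
    rw [add_sub_cancel_left, one_smul]
  · rw [if_pos (by omega), ← h]
    push_cast
    rw [sub_add_cancel_left, neg_smul, one_smul, two_smul]
    abel

/-- The formula `Pyr Ψ = (Ψ c + c Ψ + ∑ Ψ d Ψ) / 2`. -/
theorem pyramid_eq_half {u w : W} (h : cs.BruhatLE u w) :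
    b * cs.bruhatKernel u w + cs.bruhatKernel u w * a +
        ∑ v ∈ cs.bruhatIooFinset u w, cs.bruhatKernel u v * (a * b) * cs.bruhatKernel v w =
      (1 / 2 : ℚ) • (cs.bruhatKernel u w * c + c * cs.bruhatKernel u w +
        ∑ v ∈ cs.bruhatIooFinset u w, cs.bruhatKernel u v * d * cs.bruhatKernel v w) := by
  set X := b * cs.bruhatKernel u w + cs.bruhatKernel u w * a +
    ∑ v ∈ cs.bruhatIooFinset u w, cs.bruhatKernel u v * (a * b) * cs.bruhatKernel v w with hX
  -- The right side is X plus X with a and b exchanged, and these agree by the Eulerian symmetry.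
  have h1 : cs.bruhatKernel u w * c + c * cs.bruhatKernel u w +
      ∑ v ∈ cs.bruhatIooFinset u w, cs.bruhatKernel u v * d * cs.bruhatKernel v w = X + X := by
    nth_rw 2 [hX]
    rw [bruhatKernel_symmetry h, hX, c, d]
    simp only [mul_add, add_mul, Finset.sum_add_distrib]
    abel
  rw [h1, ← two_smul ℚ X, smul_smul]
  norm_num

end CoxeterSystem

/-! ### Assembly of the recursion for Bruhat intervals -/

open CoxeterSystem in
theorem mainTheorem2 {B W : Type*} [Group W] {M : CoxeterMatrix B} (cs : CoxeterSystem M W)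
    (u w s : W) (hs : s ∈ Set.range cs.simple)
    (hu : cs.BruhatLT u (u * s)) (hw : cs.BruhatLT w (w * s)) (huw : cs.BruhatLE u w) :
    (∀ x y : W, cs.BruhatLE x y → cs.bruhatIndex x y ∈ ABPoly.cdPolynomials) ∧
    (u * s ∉ cs.bruhatIcc u w →
      cs.bruhatIndex u (w * s) = abIndex (Pyr (cs.bruhatIcc u w)) ∧
      cs.bruhatIndex (u * s) (w * s) = cs.bruhatIndex u w) ∧
    (∀ hus : u * s ∈ cs.bruhatIcc u w,
      cs.bruhatIndex u (w * s) =
        abIndex (Pyr (cs.bruhatIcc u w)) -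
          ∑ v ∈ cs.bruhatIooDescents u w s,
            cs.bruhatIndex u v * ABPoly.d * cs.bruhatIndex v w ∧
      cs.bruhatIndex u (w * s) =
        (1 / 2 : ℚ) • (cs.bruhatIndex u w * ABPoly.c + ABPoly.c * cs.bruhatIndex u w +
          ∑ v ∈ cs.bruhatIooFinset u w,
            cs.sigma s v • (cs.bruhatIndex u v * ABPoly.d * cs.bruhatIndex v w)) ∧
      cs.bruhatIndex (u * s) (w * s) =
        abIndex (Shaving (⟨u * s, hus⟩ : cs.bruhatIcc u w)) -
          ∑ v ∈ cs.bruhatIooDescents (u * s) w s,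
            cs.bruhatIndex (u * s) v * ABPoly.d * cs.bruhatIndex v w ∧
      cs.bruhatIndex (u * s) (w * s) =
        cs.bruhatIndex u w +
          (1 / 2 : ℚ) • (cs.bruhatIndex (u * s) w * ABPoly.c -
            ABPoly.c * cs.bruhatIndex (u * s) w +
            ∑ v ∈ cs.bruhatIooFinset (u * s) w,
              cs.sigma s v • (cs.bruhatIndex (u * s) v * ABPoly.d * cs.bruhatIndex v w))) := by
  classical
  obtain ⟨i, rfl⟩ := hs
  refine ⟨fun x y h => bruhatIndex_mem_cdPolynomials h, ?_⟩
  have hu' := bruhatLT_mul_simple_iff.1 hu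
  have hw' := bruhatLT_mul_simple_iff.1 hw
  have hA := bruhatKernel_mul_simple_right hu' hw' huw
  have hB := bruhatKernel_mul_simple_mul_simple hu' hw' huw
  have hPyr := abIndex_pyr_bruhatIcc huw
  rw [← hPyr, bruhatKernel_of_lt ((bruhatLT_mul_simple_iff_le hu' hw').2 huw),
    sum_bruhatIooDescents_kernel] at hA
  constructor
  · intro hus
    have hus' : ¬ cs.BruhatLE (u * cs.simple i) w := fun h => hus ⟨hu.1, h⟩
    constructor
    · rw [hA, Finset.sum_eq_zero, sub_zero]
      intro v hv
      rw [mem_bruhatIooDescents] at hv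
      exact absurd ((hv.1.1.1.mul_simple_le hv.2).trans hv.1.2.1) hus'
    · by_cases he : u = w
      · rw [he, bruhatIndex_self, bruhatIndex_self]
      have hlt : cs.BruhatLT u w := ⟨huw, he⟩
      rw [bruhatKernel_of_lt ((mul_simple_bruhatLT_mul_simple_iff hu' hw').2 hlt),
        bruhatKernel_of_lt hlt, bruhatKernel_of_not_lt (fun h => hus' h.1),
        Finset.sum_eq_zero, Finset.sum_eq_zero] at hB
      · simpa using hB
      · intro v hv
        rw [mem_bruhatIooDescents] at hv
        exact absurd (hv.1.1.1.trans hv.1.2.1) hus'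
      · intro v hv
        rw [mem_bruhatIooFinset] at hv
        exact absurd (hv.1.1.trans hv.2.1) hus'
  · intro hus
    have hne : u ≠ w := by
      rintro rfl
      exact hu.2 (hu.1.antisymm hus.2)
    have hne' : u * cs.simple i ≠ w := by
      rintro rfl
      rw [simple_mul_simple_cancel_right] at hw'
      omega
    have hlt : cs.BruhatLT u w := ⟨huw, hne⟩
    have hlt' : cs.BruhatLT (u * cs.simple i) w := ⟨hus.2, hne'⟩
    have hSh := abIndex_shaving_bruhatIcc huw ⟨u * cs.simple i, hus⟩
      (length_mul_simple_of_lt hu') hne'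
    rw [bruhatKernel_of_lt ((mul_simple_bruhatLT_mul_simple_iff hu' hw').2 hlt), ← hSh,
      sum_bruhatIooDescents_kernel] at hB
    refine ⟨hA, ?_, hB, ?_⟩
    · rw [hA, hPyr, if_neg hne, zero_add, pyramid_eq_half huw, sum_sigma_smul,
        sum_bruhatIooFinset_kernel u w (fun _ x => x), bruhatKernel_of_lt hlt, ← add_sub_assoc,
        smul_sub _ _ ((2 : ℚ) • _), smul_smul]
      norm_num
    · have hhalf := pyramid_eq_half hus.2
      rw [sum_bruhatIooFinset_kernel (u * cs.simple i) w (fun _ x => x),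
        bruhatKernel_of_lt hlt'] at hhalf
      rw [hB, hSh, bruhatKernel_of_lt hlt, bruhatKernel_of_lt hlt', sum_sigma_smul]
      set r := cs.bruhatIndex (u * cs.simple i) w
      -- Since ra − ar = (br + ra) − cr, the shaving is Ψ plus the pyramid expression in r minus cr.
      -- The symmetric form of that expression then changes (rc + cr)/2 into (rc − cr)/2.
      have h1 : cs.bruhatIndex u w + r * a - a * r +
          ∑ v ∈ cs.bruhatIooFinset (u * cs.simple i) w,
            cs.bruhatKernel (u * cs.simple i) v * (a * b) * cs.bruhatKernel v w =
          cs.bruhatIndex u w + (b * r + r * a +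
          ∑ v ∈ cs.bruhatIooFinset (u * cs.simple i) w,
            cs.bruhatKernel (u * cs.simple i) v * (a * b) * cs.bruhatKernel v w) - c * r := by
        rw [c, add_mul]
        abel
      rw [h1, hhalf]
      module
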